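/- All graphs are finite, simple and undirected; a graph class is a class of graphs closed under isomorphism, and it is hereditary if it is closed under induced subgraphs. For graph classes $\Pi_1,\dots,\Pi_d$, the problem $(\Pi_1,\dots,\Pi_d)$ Vertex Deletion asks, given a graph $G$ and an integer $k\ge 0$ (the parameter), whether there is a set $Z\subseteq V(G)$ with $|Z|\le k$ such that every connected component of $G-Z$ belongs to at least one of $\Pi_1,\dots,\Pi_d$. The problem $\Pi_i$ Vertex Deletion is the case of the single class $\Pi_i$: every connected component of $G-Z$ has to belong to $\Pi_i$ (for a non-empty hereditary class closed under disjoint unions this says that $G-Z\in\Pi_i$). A graph $G$ is $(s,c)$-unbreakable if $V(G)$ has no partition into three (possibly empty) sets $X,C,Y$ with no edge between $X$ and $Y$, $|C|\le c$, $|X|\ge s$ and $|Y|\ge s$. A parameterized problem is fixed-parameter tractable (FPT) on a set of instances $(G,k)$ if there are one algorithm, a computable function $f:\mathbb N\to\mathbb N$ and a constant $c$ such that the algorithm correctly decides every instance $(G,k)$ of the set in time $f(k)\,|G|^{c}$, where $|G|$ is the size of the encoding of $G$ by its adjacency matrix; it is FPT if it is so on all instances. It is non-uniformly FPT on the set if there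 is a constant $c$ such that for every $k$ there is an algorithm that correctly decides every instance of the set with parameter $k$ in time $O_k(|G|^{c})$. **Theorem.** Let $d\ge 0$ and let $\Pi_1,\dots,\Pi_d$ be hereditary graph classes such that, for every $i$, $\Pi_i$ Vertex Deletion is FPT. Let $s:\mathbb N\to\mathbb N$ be any function. If $s$ is computable, then $(\Pi_1,\dots,\Pi_d)$ Vertex Deletion is FPT on the instances $(G,k)$ in which $G$ is $(s(k),k)$-unbreakable. If $s$ is arbitrary, then $(\Pi_1,\dots,\Pi_d)$ Vertex Deletion is non-uniformly FPT on these instances. -/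

import Mathlib

/-!
# Vertex deletion to scattered graph classes

Graph classes, the vertex deletion problem, unbreakable graphs, and fixed-parameter tractability
over an explicit programming language with a step count.
-/

namespace Scattered

/-! ## Model of computation: WHILE programs over binary trees

Jones' textbook language WHILE. Data are binary trees, variables are numbered by `ℕ`, the only
operations are `nil`, `cons`, `hd`, `tl`, and the only test is whether a tree is `nil`. Every
elementary operation costs one unit. (Trees can be stored as shared pointers, so that running times
agree with those of multitape Turing machines up to a polynomial.) -/

/-- Binary trees, the data of the language. -/
inductive Data : Type
  | nil : Data
  | cons : Data → Data → Data

namespace Data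

/-- Left subtree (`nil` for `nil`). -/
def hd : Data → Data
  | nil => nil
  | cons a _ => a

/-- Right subtree (`nil` for `nil`). -/
def tl : Data → Data
  | nil => nil
  | cons _ b => b

/-- Number of nodes, leaves included; in particular it is positive. -/
def size : Data → ℕ
  | nil => 1
  | cons a b => a.size + b.size + 1

/-- A bit: `false` is `nil`, `true` is the one other tree of least size. -/
def ofBool : Bool → Data
  | false => nil
  | true => cons nil nil

/-- A list, as a right comb. -/
def ofList : List Data → Data
  | [] => nil
  | a :: l => cons a (ofList l)

/-- A natural number in unary. -/
def ofNat (k : ℕ) : Data := ofList (List.replicate k nil)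

end Data

/-- Values of the variables. -/
abbrev Store : Type := ℕ → Data

/-- Expressions. -/
inductive Expr : Type
  | var : ℕ → Expr
  | nil : Expr
  | cons : Expr → Expr → Expr
  | hd : Expr → Expr
  | tl : Expr → Expr

namespace Expr

/-- Value of an expression. -/
def eval (σ : Store) : Expr → Data
  | var i => σ i
  | nil => Data.nil
  | cons a b => Data.cons (a.eval σ) (b.eval σ)
  | hd a => (a.eval σ).hd
  | tl a => (a.eval σ).tl

/-- Time to evaluate an expression: one unit for each of its operations. -/
def cost : Expr → ℕ
  | var _ => 1
  | nil => 1
  | cons a b => a.cost + b.cost + 1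
  | hd a => a.cost + 1
  | tl a => a.cost + 1

end Expr

/-- Programs. -/
inductive Prog : Type
  | assign : ℕ → Expr → Prog
  | seq : Prog → Prog → Prog
  | ite : Expr → Prog → Prog → Prog
  | loop : Expr → Prog → Prog

/-- `Exec p σ τ t`: the program `p`, started in the store `σ`, halts in the store `τ` after
exactly `t` units of time. The guard of `ite` and of the while loop `loop` holds if its value is
not `nil`. -/
inductive Exec : Prog → Store → Store → ℕ → Prop
  | assign (i : ℕ) (e : Expr) (σ : Store) :
      Exec (.assign i e) σ (Function.update σ i (e.eval σ)) (e.cost + 1)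
  | seq {p q : Prog} {σ τ ρ : Store} {t u : ℕ} :
      Exec p σ τ t → Exec q τ ρ u → Exec (.seq p q) σ ρ (t + u + 1)
  | ite_true {e : Expr} {p q : Prog} {σ τ : Store} {t : ℕ} :
      e.eval σ ≠ Data.nil → Exec p σ τ t → Exec (.ite e p q) σ τ (e.cost + t + 1)
  | ite_false {e : Expr} {p q : Prog} {σ τ : Store} {t : ℕ} :
      e.eval σ = Data.nil → Exec q σ τ t → Exec (.ite e p q) σ τ (e.cost + t + 1)
  | loop_true {e : Expr} {p : Prog} {σ τ ρ : Store} {t u : ℕ} :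
      e.eval σ ≠ Data.nil → Exec p σ τ t → Exec (.loop e p) τ ρ u →
      Exec (.loop e p) σ ρ (e.cost + t + u + 1)
  | loop_false {e : Expr} {p : Prog} {σ : Store} :
      e.eval σ = Data.nil → Exec (.loop e p) σ σ (e.cost + 1)

/-- The initial store: the input is in variable `0`, all other variables are `nil`. -/
def initStore (x : Data) : Store := Function.update (fun _ => Data.nil) 0 x

/-- On input `x` the program `p` halts within `T` units of time, and it accepts (variable `0` is not
`nil` at the end) if and only if `b` holds. -/
def DecidesWithin (p : Prog) (x : Data) (b : Prop) (T : ℕ) : Prop :=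
  ∃ τ t, Exec p (initStore x) τ t ∧ t ≤ T ∧ (τ 0 ≠ Data.nil ↔ b)

/-! ## Parameterized graph problems -/

open Classical in
/-- A graph on `{0, …, n - 1}` is given by its adjacency matrix, as the list of its rows. -/
noncomputable def encodeGraph {n : ℕ} (G : SimpleGraph (Fin n)) : Data :=
  Data.ofList (List.ofFn fun i : Fin n =>
    Data.ofList (List.ofFn fun j : Fin n => Data.ofBool (decide (G.Adj i j))))

/-- The input `(G, k)`, with `k` in unary. -/
noncomputable def encodeInstance {n : ℕ} (G : SimpleGraph (Fin n)) (k : ℕ) : Data :=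
  Data.cons (encodeGraph G) (Data.ofNat k)

/-- A parameterized graph problem: a property of instances `(G, k)`, `k` being the parameter. -/
abbrev GraphProblem : Type := ∀ n : ℕ, SimpleGraph (Fin n) → ℕ → Prop

/-- The problem `L` is fixed-parameter tractable on the instances that satisfy `P`: one program
decides each of them in time `f(k) · |x| ^ c`, where `f` is computable and `|x|` is the size of the
encoded graph. Nothing is asked of the program on other instances. -/
def FPTOn (P L : GraphProblem) : Prop :=
  ∃ (p : Prog) (f : ℕ → ℕ) (c : ℕ), Computable f ∧
    ∀ (n : ℕ) (G : SimpleGraph (Fin n)) (k : ℕ), P n G k →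
      DecidesWithin p (encodeInstance G k) (L n G k) (f k * (encodeGraph G).size ^ c)

/-- The problem `L` is fixed-parameter tractable. -/
def FPT (L : GraphProblem) : Prop := FPTOn (fun _ _ _ => True) L

/-- The problem `L` is non-uniformly fixed-parameter tractable on the instances that satisfy `P`:
there are an exponent `c` and, for every `k`, a program that decides the instances with parameter
`k` in time `O(|x| ^ c)`, with a constant that may depend on `k`. -/
def NonuniformFPTOn (P L : GraphProblem) : Prop :=
  ∃ c : ℕ, ∀ k : ℕ, ∃ (p : Prog) (a : ℕ),
    ∀ (n : ℕ) (G : SimpleGraph (Fin n)), P n G k →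
      DecidesWithin p (encodeInstance G k) (L n G k) (a * (encodeGraph G).size ^ c)

/-! ## Graph classes and vertex deletion -/

/-- A class of finite graphs, closed under isomorphism. -/
structure GraphClass where
  /-- Membership of a finite graph in the class. -/
  Mem : ∀ {V : Type} [Finite V], SimpleGraph V → Prop
  /-- Membership depends on the isomorphism type only. -/
  mem_of_iso : ∀ {V W : Type} [Finite V] [Finite W] (G : SimpleGraph V) (H : SimpleGraph W),
    Nonempty (G ≃g H) → Mem G → Mem H

/-- A class is hereditary if it is closed under induced subgraphs. -/
def GraphClass.IsHereditary (Γ : GraphClass) : Prop :=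
  ∀ {V : Type} [Finite V] (G : SimpleGraph V) (S : Set V), Γ.Mem G → Γ.Mem (G.induce S)

/-- Every connected component of `G` is in at least one of the classes `Γ i`. -/
def ComponentsIn {ι : Type} (Γ : ι → GraphClass) {V : Type} [Finite V] (G : SimpleGraph V) : Prop :=
  ∀ C : G.ConnectedComponent, ∃ i, (Γ i).Mem (G.induce C.supp)

/-- The problem `(Γ₁, …, Γ_d)` Vertex Deletion: is there a set `Z` of at most `k` vertices such that
every connected component of `G - Z` is in at least one of the classes? -/
def VertexDeletion {ι : Type} (Γ : ι → GraphClass) : GraphProblem := fun n G k =>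
  ∃ Z : Finset (Fin n), Z.card ≤ k ∧ ComponentsIn Γ (G.induce {v | v ∉ Z})

/-- `G` is `(s, c)`-unbreakable: its vertex set has no partition into `X`, `C`, `Y` with no edge
between `X` and `Y`, with `|C| ≤ c`, and with `|X|, |Y| ≥ s`. -/
def IsUnbreakable {n : ℕ} (G : SimpleGraph (Fin n)) (s c : ℕ) : Prop :=
  ¬ ∃ X C Y : Finset (Fin n),
    X ∪ C ∪ Y = Finset.univ ∧ Disjoint X C ∧ Disjoint X Y ∧ Disjoint C Y ∧
    (∀ x ∈ X, ∀ y ∈ Y, ¬ G.Adj x y) ∧ C.card ≤ c ∧ s ≤ X.card ∧ s ≤ Y.card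

/-- The instances `(G, k)` with `G` an `(s k, k)`-unbreakable graph. -/
def UnbreakableInstances (s : ℕ → ℕ) : GraphProblem := fun _ G k => IsUnbreakable G (s k) k

end Scattered

/-!
Fix a solution. In an unbreakable graph all but boundedly many vertices outside of it lie in one
component, in the `i`-th class say. Label every vertex as deleted or by a class of its component:
at most `T = k + 3 s(k)` vertices get a label other than `i`, so there is a modulator of size at
most `T` to the `i`-th class, and the program for that class finds one, `M`, by self-reduction.
Choosing `i` wherever the `i`-th class permits it, every component with another label is not in
the `i`-th class and hence meets `M`. So all labels other than `i` are found by branching over the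
labels of vertices that are in `M` or adjacent to a vertex labelled by a class other than `i`: the
search ends after `2 T` rounds, and the programs for the single classes check the
`(d + 1) ^ (2 T)` results.

Running times are handled by a calculus of polynomial-time functions on types with an encoding and
a weight that may exceed the size of the encoding, which makes functions of the parameter
polynomial. If `s` is computable, a program for it, which halts after a computable number of
steps, is obtained from a code for `s` as a recursive function; otherwise `T` is a constant in the
program for `k`.
-/

namespace Scattered

/-! ## Programs that leave their work variables clean -/

namespace Store

/-- The store that holds `x` in variable `0` and the contents of `σ`, moved up by one variable,
above it. Stores are written out as `push x₀ (push x₁ …)`. -/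
def push (x : Data) (σ : Store) : Store
  | 0 => x
  | i + 1 => σ i

@[simp] theorem push_zero (x : Data) (σ : Store) : push x σ 0 = x := rfl

@[simp] theorem push_succ (x : Data) (σ : Store) (i : ℕ) : push x σ (i + 1) = σ i := rfl

@[simp] theorem update_push_zero (x y : Data) (σ : Store) :
    Function.update (push x σ) 0 y = push y σ := by
  funext i
  cases i <;> simp

@[simp] theorem update_push_succ (x y : Data) (σ : Store) (i : ℕ) :
    Function.update (push x σ) (i + 1) y = push x (Function.update σ i y) := by
  funext j
  cases j <;> simp [Function.update_apply]

end Store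

open Store

theorem push_nil : push .nil (fun _ => .nil) = fun _ => .nil := by
  funext i
  cases i <;> rfl

theorem initStore_eq_push (x : Data) : initStore x = push x fun _ => .nil := by
  conv_lhs => rw [initStore, ← push_nil, update_push_zero]

theorem initStore_eq_push_push_push (x : Data) :
    initStore x = push x (push .nil (push .nil fun _ => .nil)) := by
  rw [push_nil, push_nil, initStore_eq_push]

@[simp] theorem initStore_zero (x : Data) : initStore x 0 = x := by simp [initStore]

theorem initStore_of_ne_zero (x : Data) {i : ℕ} (hi : i ≠ 0) : initStore x i = .nil := by
  simp [initStore, hi]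

namespace Expr

/-- Renaming of the variables `i ↦ i + 1`. -/
def shift : Expr → Expr
  | var i => var (i + 1)
  | nil => nil
  | cons a b => cons a.shift b.shift
  | hd a => hd a.shift
  | tl a => tl a.shift

@[simp] theorem eval_shift (e : Expr) (x : Data) (σ : Store) :
    e.shift.eval (push x σ) = e.eval σ := by
  induction e <;> simp_all [shift, eval]

@[simp] theorem cost_shift (e : Expr) : e.shift.cost = e.cost := by
  induction e <;> simp_all [shift, cost]

end Expr

namespace Prog

/-- Renaming of the variables `i ↦ i + 1`. -/
def shift : Prog → Prog
  | assign i e => assign (i + 1) e.shift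
  | seq p q => seq p.shift q.shift
  | ite e p q => ite e.shift p.shift q.shift
  | loop e p => loop e.shift p.shift

/-- All variables that the program assigns to are less than this number. -/
def bound : Prog → ℕ
  | assign i _ => i + 1
  | seq p q => max p.bound q.bound
  | ite _ p q => max p.bound q.bound
  | loop _ p => p.bound

end Prog

namespace Exec

theorem shift {p : Prog} {σ τ : Store} {t : ℕ} (h : Exec p σ τ t) (x : Data) :
    Exec p.shift (push x σ) (push x τ) t := by
  induction h with
  | assign i e σ => simpa [Prog.shift] using Exec.assign (i + 1) e.shift (push x σ)
  | seq _ _ ih₁ ih₂ => exact ih₁.seq ih₂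
  | ite_true hg _ ih => simpa [Prog.shift] using ih.ite_true ((Expr.eval_shift _ x _).trans_ne hg)
  | ite_false hg _ ih => simpa [Prog.shift] using ih.ite_false ((Expr.eval_shift _ x _).trans hg)
  | loop_true hg _ _ ih₁ ih₂ =>
    simpa [Prog.shift] using ih₁.loop_true ((Expr.eval_shift _ x _).trans_ne hg) ih₂
  | loop_false hg =>
    simpa [Prog.shift] using Exec.loop_false ((Expr.eval_shift _ x _).trans hg)

theorem eq_of_bound_le {p : Prog} {σ τ : Store} {t : ℕ} (h : Exec p σ τ t) {i : ℕ}
    (hi : p.bound ≤ i) : τ i = σ i := by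
  induction h with
  | assign j e σ => exact Function.update_of_ne (Nat.succ_le_iff.mp hi).ne' ..
  | seq _ _ ih₁ ih₂ => rw [ih₂ (le_of_max_le_right hi), ih₁ (le_of_max_le_left hi)]
  | ite_true _ _ ih => exact ih (le_of_max_le_left hi)
  | ite_false _ _ ih => exact ih (le_of_max_le_right hi)
  | loop_true _ _ _ ih₁ ih₂ => rw [ih₂ hi, ih₁ hi]
  | loop_false _ => rfl

end Exec

/-- `p` turns the input `x` into the output `y` within `t` units of time, and all variables but `0`
are `nil` at the end, as they are at the beginning, so that such programs can be composed. -/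
def Run (p : Prog) (x y : Data) (t : ℕ) : Prop :=
  ∃ u ≤ t, Exec p (initStore x) (initStore y) u

namespace Run

theorem mono {p : Prog} {x y : Data} {t u : ℕ} (h : Run p x y t) (htu : t ≤ u) : Run p x y u :=
  let ⟨v, hv, h⟩ := h
  ⟨v, hv.trans htu, h⟩

theorem assign (e : Expr) (x : Data) :
    Run (.assign 0 e) x (e.eval (initStore x)) (e.cost + 1) :=
  ⟨_, le_rfl, by simpa [initStore_eq_push] using Exec.assign 0 e (initStore x)⟩

theorem seq {p q : Prog} {x y z : Data} {t u : ℕ} (h₁ : Run p x y t) (h₂ : Run q y z u) :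
    Run (.seq p q) x z (t + u + 1) := by
  obtain ⟨t', ht, h₁⟩ := h₁
  obtain ⟨u', hu, h₂⟩ := h₂
  exact ⟨_, by omega, h₁.seq h₂⟩

theorem ite_true {e : Expr} {p q : Prog} {x y : Data} {t : ℕ}
    (hg : e.eval (initStore x) ≠ .nil) (h : Run p x y t) :
    Run (.ite e p q) x y (e.cost + t + 1) := by
  obtain ⟨t', ht, h⟩ := h
  exact ⟨_, by omega, h.ite_true hg⟩

theorem ite_false {e : Expr} {p q : Prog} {x y : Data} {t : ℕ}
    (hg : e.eval (initStore x) = .nil) (h : Run q x y t) :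
    Run (.ite e p q) x y (e.cost + t + 1) := by
  obtain ⟨t', ht, h⟩ := h
  exact ⟨_, by omega, h.ite_false hg⟩

theorem loop_true {e : Expr} {p : Prog} {x y z : Data} {t u : ℕ}
    (hg : e.eval (initStore x) ≠ .nil) (h₁ : Run p x y t) (h₂ : Run (.loop e p) y z u) :
    Run (.loop e p) x z (e.cost + t + u + 1) := by
  obtain ⟨t', ht, h₁⟩ := h₁
  obtain ⟨u', hu, h₂⟩ := h₂
  exact ⟨_, by omega, h₁.loop_true hg h₂⟩

theorem loop_false {e : Expr} {p : Prog} {x : Data} (hg : e.eval (initStore x) = .nil) :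
    Run (.loop e p) x x (e.cost + 1) :=
  ⟨_, le_rfl, .loop_false hg⟩

theorem decidesWithin {p : Prog} {x : Data} {b : Bool} {t : ℕ} (h : Run p x (.ofBool b) t) :
    DecidesWithin p x (b = true) t := by
  obtain ⟨u, hu, h⟩ := h
  exact ⟨_, _, h, hu, by cases b <;> simp [Data.ofBool]⟩

end Run

namespace Prog

/-- Runs `p` and `q` on the same input and pairs the outputs. -/
def pair (p q : Prog) : Prog :=
  seq (assign 2 (.var 0)) <| seq p.shift.shift <| seq (assign 1 (.var 2)) <|
  seq (assign 2 (.var 0)) <| seq q.shift.shift <| seq (assign 0 (.cons (.var 1) (.var 2))) <|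
  seq (assign 1 .nil) (assign 2 .nil)

/-- Runs `p` or `q`, according to the output of `c`, on the input of `c`. -/
def cond (c p q : Prog) : Prog :=
  seq (c.pair (assign 0 (.var 0))) <|
  ite (.hd (.var 0)) (seq (assign 0 (.tl (.var 0))) p) (seq (assign 0 (.tl (.var 0))) q)

/-- Sets the variables `1, …, m` to `nil`. -/
def clear : ℕ → Prog
  | 0 => assign 0 (.var 0)
  | m + 1 => seq (clear m) (assign (m + 1) .nil)

/-- Decides what `p` decides, with the answer `Data.ofBool b` and all other variables `nil`. -/
def clean (p : Prog) : Prog :=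
  seq p <| seq (ite (.var 0) (assign 0 (.cons .nil .nil)) (assign 0 .nil)) (clear p.bound)

end Prog

theorem Exec.assign_of_eq {i : ℕ} {e : Expr} {σ τ : Store}
    (h : Function.update σ i (e.eval σ) = τ) : Exec (.assign i e) σ τ (e.cost + 1) :=
  h ▸ .assign i e σ

theorem Run.pair {p q : Prog} {x y z : Data} {t u : ℕ} (hp : Run p x y t) (hq : Run q x z u) :
    Run (p.pair q) x (.cons y z) (t + u + 25) := by
  obtain ⟨t', ht, hp⟩ := hp
  obtain ⟨u', hu, hq⟩ := hq
  let σ (a b c : Data) : Store := push a (push b (push c fun _ => .nil))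
  have start (a : Data) : initStore a = σ a .nil .nil := initStore_eq_push_push_push a
  have work (a b c : Data) : push a (push b (initStore c)) = σ a b c := by
    rw [initStore_eq_push]
  have load : Exec (.assign 2 (.var 0)) (σ x .nil .nil) (σ x .nil x) 2 :=
    .assign_of_eq (by simp [σ, Expr.eval])
  have run_p : Exec p.shift.shift (σ x .nil x) (σ x .nil y) t' := by
    simpa only [work] using (hp.shift .nil).shift x
  have save : Exec (.assign 1 (.var 2)) (σ x .nil y) (σ x y y) 2 :=
    .assign_of_eq (by simp [σ, Expr.eval])
  have reload : Exec (.assign 2 (.var 0)) (σ x y y) (σ x y x) 2 :=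
    .assign_of_eq (by simp [σ, Expr.eval])
  have run_q : Exec q.shift.shift (σ x y x) (σ x y z) u' := by
    simpa only [work] using (hq.shift y).shift x
  have output : Exec (.assign 0 (.cons (.var 1) (.var 2))) (σ x y z) (σ (.cons y z) y z) 4 :=
    .assign_of_eq (by simp [σ, Expr.eval])
  have clear₁ : Exec (.assign 1 .nil) (σ (.cons y z) y z) (σ (.cons y z) .nil z) 2 :=
    .assign_of_eq (by simp [σ, Expr.eval])
  have clear₂ : Exec (.assign 2 .nil) (σ (.cons y z) .nil z) (σ (.cons y z) .nil .nil) 2 :=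
    .assign_of_eq (by simp [σ, Expr.eval])
  refine ⟨_, ?_, by
    simpa only [start, Prog.pair] using load.seq <| run_p.seq <| save.seq <| reload.seq <|
      run_q.seq <| output.seq <| clear₁.seq clear₂⟩
  omega

theorem Run.cond {c p q : Prog} {x b y : Data} {t u : ℕ} (hc : Run c x b t)
    (hp : b ≠ .nil → Run p x y u) (hq : b = .nil → Run q x y u) :
    Run (c.cond p q) x y (t + u + 40) := by
  have test : Run (c.pair (.assign 0 (.var 0))) x (.cons b x) (t + 2 + 25) := by
    simpa [Expr.eval, Expr.cost] using hc.pair (Run.assign (.var 0) x)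
  have restore : Run (.assign 0 (.tl (.var 0))) (.cons b x) x 3 := by
    simpa [Expr.eval, Expr.cost, Data.tl] using Run.assign (.tl (.var 0)) (.cons b x)
  have guard : (Expr.hd (.var 0)).eval (initStore (.cons b x)) = b := by simp [Expr.eval, Data.hd]
  by_cases hb : b = .nil
  · exact (test.seq (.ite_false (guard.trans hb) (restore.seq (hq hb)))).mono (by
      simp only [Expr.cost]; omega)
  · exact (test.seq (.ite_true (guard.trans_ne hb) (restore.seq (hp hb)))).mono (by
      simp only [Expr.cost]; omega)

theorem Exec.clear (m : ℕ) (σ : Store) :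
    Exec (.clear m) σ (fun i => if i ∈ Finset.Icc 1 m then .nil else σ i) (3 * m + 2) := by
  induction m with
  | zero => exact .assign_of_eq (by simp [Expr.eval])
  | succ m ih =>
    refine (ih.seq (.assign_of_eq (i := m + 1) (e := .nil) ?_) :)
    funext i
    simp only [Function.update_apply, Expr.eval, Finset.mem_Icc]
    grind

theorem Run.clean {p : Prog} {x : Data} {b : Bool} {t : ℕ} (h : DecidesWithin p x (b = true) t) :
    Run p.clean x (.ofBool b) (t + 3 * p.bound + 15) := by
  obtain ⟨τ, t', hp, ht, hb⟩ := h
  have normalize : ∃ u ≤ 6, Exec (.ite (.var 0) (.assign 0 (.cons .nil .nil)) (.assign 0 .nil)) τ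
      (Function.update τ 0 (.ofBool b)) u := by
    by_cases h0 : τ 0 = .nil
    · obtain rfl : b = false := by simpa [h0] using hb
      exact ⟨_, by simp [Expr.cost], .ite_false h0 (.assign 0 .nil τ)⟩
    · obtain rfl : b = true := by simpa [h0] using hb
      exact ⟨_, by simp [Expr.cost], .ite_true h0 (.assign 0 (.cons .nil .nil) τ)⟩
  obtain ⟨u, hu, normalize⟩ := normalize
  have cleared : (fun i => if i ∈ Finset.Icc 1 p.bound then .nil else
      Function.update τ 0 (.ofBool b) i) = initStore (.ofBool b) := by
    funext i
    rcases eq_or_ne i 0 with rfl | hi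
    · simp
    · have untouched (h : p.bound < i) : τ i = .nil := by
        rw [hp.eq_of_bound_le h.le, initStore_of_ne_zero x hi]
      simp only [Finset.mem_Icc, Function.update_of_ne hi, initStore_of_ne_zero _ hi]
      grind
  exact ⟨_, by omega, cleared ▸ hp.seq (normalize.seq (.clear p.bound _))⟩

/-! ## Polynomial time -/

/-- A type with an encoding by trees and a weight, which stands for the size of an element. The
weight may exceed the size of the encoding, so that running times can be bounded in terms of data
that are not encoded; this is how factors `f k` are hidden in polynomial bounds. -/
class Enc (α : Type) where
  /-- The encoding. -/
  enc : α → Data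
  /-- The weight. -/
  weight : α → ℕ

open Enc

instance : Enc Bool := ⟨Data.ofBool, fun b => (Data.ofBool b).size⟩

instance : Enc ℕ := ⟨Data.ofNat, fun n => 2 * n + 1⟩

instance : Enc Unit := ⟨fun _ => .nil, fun _ => 1⟩

instance {α β : Type} [Enc α] [Enc β] : Enc (α × β) :=
  ⟨fun x => .cons (enc x.1) (enc x.2), fun x => weight x.1 + weight x.2 + 1⟩

instance {α : Type} [Enc α] : Enc (List α) :=
  ⟨fun l => Data.ofList (l.map enc), fun l => (l.map fun a => weight a + 1).sum + 1⟩

section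

variable {α β γ σ : Type} [Enc α] [Enc β] [Enc γ] [Enc σ]

@[simp] theorem enc_mk (a : α) (b : β) : enc (a, b) = .cons (enc a) (enc b) := rfl

@[simp] theorem weight_mk (a : α) (b : β) : weight (a, b) = weight a + weight b + 1 := rfl

@[simp] theorem enc_list_nil : enc ([] : List α) = .nil := rfl

@[simp] theorem enc_list_cons (a : α) (l : List α) : enc (a :: l) = .cons (enc a) (enc l) := rfl

@[simp] theorem weight_list_nil : weight ([] : List α) = 1 := rfl

@[simp] theorem weight_list_cons (a : α) (l : List α) :
    weight (a :: l) = weight a + weight l + 1 := by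
  simp only [weight, List.map_cons, List.sum_cons]
  omega

@[simp] theorem enc_zero : enc (0 : ℕ) = .nil := rfl

@[simp] theorem enc_succ (n : ℕ) : enc (n + 1) = .cons .nil (enc n) := by
  simp [enc, Data.ofNat, List.replicate_succ, Data.ofList]

@[simp] theorem weight_nat (n : ℕ) : weight n = 2 * n + 1 := rfl

@[simp] theorem weight_unit (u : Unit) : weight u = 1 := rfl

@[simp] theorem enc_false : enc false = .nil := rfl

@[simp] theorem enc_true : enc true = .cons .nil .nil := rfl

theorem enc_bool_eq_nil {b : Bool} : enc b = .nil ↔ b = false := by cases b <;> simp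

theorem weight_bool_le (b : Bool) : weight b ≤ 3 := by cases b <;> decide

theorem weight_list_append (l l' : List α) : weight (l ++ l') + 1 = weight l + weight l' := by
  induction l with
  | nil => simp [add_comm]
  | cons a l ih => simp only [List.cons_append, weight_list_cons]; omega

theorem length_lt_weight (l : List α) : l.length < weight l := by
  induction l with
  | nil => simp
  | cons a l ih => simp only [List.length_cons, weight_list_cons]; omega

theorem weight_lt_of_mem {a : α} {l : List α} (h : a ∈ l) : weight a < weight l := by
  induction l with
  | nil => simp at h
  | cons b l ih =>
    rw [weight_list_cons]
    rcases List.mem_cons.1 h with rfl | h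
    · omega
    · exact (ih h).trans (by omega)

theorem weight_list_le {l : List α} {m : ℕ} (h : ∀ a ∈ l, weight a ≤ m) :
    weight l ≤ l.length * (m + 1) + 1 := by
  induction l with
  | nil => simp
  | cons a l ih =>
    rw [List.forall_mem_cons] at h
    rw [weight_list_cons, List.length_cons]
    linarith [h.1, ih h.2]

theorem weight_list_unit (l : List Unit) : weight l = 2 * l.length + 1 := by
  induction l with
  | nil => rfl
  | cons a l ih => simp only [weight_list_cons, List.length_cons, weight_unit, ih]; omega

theorem enc_list_unit (l : List Unit) : enc l = enc l.length := by
  induction l with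
  | nil => rfl
  | cons a l ih => rw [List.length_cons, enc_succ, ← ih]; rfl

/-- A function bounded by a polynomial in the weight. -/
@[fun_prop]
def PolyBounded (f : α → ℕ) : Prop := ∃ c, ∀ a, f a ≤ (weight a + 2) ^ c

namespace PolyBounded

theorem mono {f g : α → ℕ} (hg : PolyBounded g) (h : ∀ a, f a ≤ g a) : PolyBounded f :=
  let ⟨c, hc⟩ := hg
  ⟨c, fun a => (h a).trans (hc a)⟩

@[fun_prop]
theorem weight : PolyBounded (weight : α → ℕ) := ⟨1, fun a => by simp⟩

@[fun_prop]
theorem const (n : ℕ) : PolyBounded fun _ : α => n :=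
  ⟨n, fun _ => Nat.lt_two_pow_self.le.trans (Nat.pow_le_pow_left (by omega) n)⟩

@[fun_prop]
theorem mul {f g : α → ℕ} (hf : PolyBounded f) (hg : PolyBounded g) :
    PolyBounded fun a => f a * g a := by
  obtain ⟨c, hc⟩ := hf
  obtain ⟨d, hd⟩ := hg
  exact ⟨c + d, fun a => by rw [pow_add]; exact Nat.mul_le_mul (hc a) (hd a)⟩

@[fun_prop]
theorem add {f g : α → ℕ} (hf : PolyBounded f) (hg : PolyBounded g) :
    PolyBounded fun a => f a + g a := by
  obtain ⟨c, hc⟩ := hf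
  obtain ⟨d, hd⟩ := hg
  refine ⟨max c d + 1, fun a => ?_⟩
  have two_le : 2 ≤ Enc.weight a + 2 := by omega
  calc f a + g a
      ≤ (Enc.weight a + 2) ^ max c d + (Enc.weight a + 2) ^ max c d := by
        gcongr
        · exact (hc a).trans (Nat.pow_le_pow_right (by omega) (le_max_left c d))
        · exact (hd a).trans (Nat.pow_le_pow_right (by omega) (le_max_right c d))
    _ = (Enc.weight a + 2) ^ max c d * 2 := by ring
    _ ≤ (Enc.weight a + 2) ^ (max c d + 1) := by
        rw [pow_succ]
        gcongr

@[fun_prop]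
theorem pow {f : α → ℕ} (hf : PolyBounded f) (n : ℕ) : PolyBounded fun a => f a ^ n := by
  obtain ⟨c, hc⟩ := hf
  exact ⟨c * n, fun a => by rw [pow_mul]; exact Nat.pow_le_pow_left (hc a) n⟩

theorem comp {f : β → ℕ} {g : α → β} (hf : PolyBounded f)
    (hg : PolyBounded fun a => Enc.weight (g a)) : PolyBounded fun a => f (g a) := by
  obtain ⟨c, hc⟩ := hf
  have := hg
  exact mono (g := fun a => (Enc.weight (g a) + 2) ^ c) (by fun_prop) fun a => hc (g a)

end PolyBounded

/-- `f` is computed by a program in time polynomial in the weight, and its values have polynomial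
weight. -/
@[fun_prop]
def PolyTime (f : α → β) : Prop :=
  ∃ p : Prog, ∃ T : α → ℕ, PolyBounded T ∧ (∀ a, Run p (enc a) (enc (f a)) (T a)) ∧
    PolyBounded fun a => weight (f a)

namespace PolyTime

theorem polyBounded {f : α → β} (h : PolyTime f) : PolyBounded fun a => weight (f a) :=
  let ⟨_, _, _, _, hf⟩ := h
  hf

theorem of_expr (e : Expr) {f : α → β} (h : ∀ a, e.eval (initStore (enc a)) = enc (f a))
    (hf : PolyBounded fun a => weight (f a)) : PolyTime f :=
  ⟨.assign 0 e, fun _ => e.cost + 1, .const _, fun a => h a ▸ Run.assign e (enc a), hf⟩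

theorem of_enc_eq {f : α → β} (h : ∀ a, enc (f a) = enc a) (hf : ∀ a, weight (f a) ≤ weight a) :
    PolyTime f :=
  of_expr (.var 0) (fun a => by simp [Expr.eval, h]) (PolyBounded.weight.mono hf)

@[fun_prop]
theorem id : PolyTime fun a : α => a := of_enc_eq (fun _ => rfl) fun _ => le_rfl

@[fun_prop]
theorem comp {g : β → γ} {f : α → β} (hg : PolyTime g) (hf : PolyTime f) :
    PolyTime fun a => g (f a) := by
  obtain ⟨p, T, hT, hp, hgw⟩ := hg
  obtain ⟨q, U, hU, hq, hfw⟩ := hf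
  exact ⟨q.seq p, fun a => U a + T (f a) + 1, .add (.add hU (hT.comp hfw)) (.const 1),
    fun a => (hq a).seq (hp (f a)), hgw.comp hfw⟩

@[fun_prop]
theorem pair {f : α → β} {g : α → γ} (hf : PolyTime f) (hg : PolyTime g) :
    PolyTime fun a => (f a, g a) := by
  obtain ⟨p, T, hT, hp, hfw⟩ := hf
  obtain ⟨q, U, hU, hq, hgw⟩ := hg
  exact ⟨p.pair q, fun a => T a + U a + 25, by fun_prop, fun a => (hp a).pair (hq a),
    .add (.add hfw hgw) (.const 1)⟩

@[fun_prop]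
theorem fst {f : α → β × γ} (hf : PolyTime f) : PolyTime fun a => (f a).1 :=
  comp (g := Prod.fst) (of_expr (.hd (.var 0)) (fun a => by simp [Expr.eval, enc, Data.hd])
    (PolyBounded.weight.mono fun ⟨b, c⟩ => by simp only [weight_mk]; omega)) hf

@[fun_prop]
theorem snd {f : α → β × γ} (hf : PolyTime f) : PolyTime fun a => (f a).2 :=
  comp (g := Prod.snd) (of_expr (.tl (.var 0)) (fun a => by simp [Expr.eval, enc, Data.tl])
    (PolyBounded.weight.mono fun ⟨b, c⟩ => by simp only [weight_mk]; omega)) hf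

end PolyTime

end

/-- An expression whose value is the given tree. -/
def Data.toExpr : Data → Expr
  | nil => .nil
  | cons a b => .cons a.toExpr b.toExpr

theorem Data.eval_toExpr (x : Data) (σ : Store) : x.toExpr.eval σ = x := by
  induction x <;> simp_all [toExpr, Expr.eval]

namespace PolyTime

variable {α β γ σ : Type} [Enc α] [Enc β] [Enc γ] [Enc σ]

@[fun_prop]
theorem const (b : β) : PolyTime fun _ : α => b :=
  of_expr (enc b).toExpr (fun _ => Data.eval_toExpr _ _) (.const _)

@[fun_prop]
theorem cond {c : α → Bool} {f g : α → β} (hc : PolyTime c) (hf : PolyTime f) (hg : PolyTime g) :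
    PolyTime fun a => if c a then f a else g a := by
  obtain ⟨p, T, hT, hp, -⟩ := hc
  obtain ⟨q, U, hU, hq, hfw⟩ := hf
  obtain ⟨r, W, hW, hr, hgw⟩ := hg
  refine ⟨p.cond q r, fun a => T a + (U a + W a) + 40, by fun_prop,
    fun a => (hp a).cond (fun h => ?_) fun h => ?_, (hfw.add hgw).mono fun a => by grind⟩
  · rw [Ne, enc_bool_eq_nil, Bool.not_eq_false] at h
    simpa only [h, if_true] using (hq a).mono (Nat.le_add_right ..)
  · rw [enc_bool_eq_nil] at h
    simpa only [h, Bool.false_eq_true, if_false] using (hr a).mono (Nat.le_add_left ..)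

@[fun_prop]
theorem list_cons {f : α → β} {g : α → List β} (hf : PolyTime f) (hg : PolyTime g) :
    PolyTime fun a => f a :: g a :=
  comp (g := fun x : β × List β => x.1 :: x.2)
    (of_enc_eq (fun _ => rfl) fun x => (weight_list_cons x.1 x.2).le) (hf.pair hg)

@[fun_prop]
theorem list_tail {f : α → List β} (hf : PolyTime f) : PolyTime fun a => (f a).tail :=
  comp (g := List.tail) (of_expr (.tl (.var 0))
    (fun l => by cases l <;> simp [Expr.eval, Data.tl])
    (PolyBounded.weight.mono fun l => by cases l <;> simp; omega)) hf

-- A pair `(a, b :: l)` has the same encoding and the same weight as the triple `(a, b, l)`.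
theorem list_cases {f : α → List β} {g : α → γ} {h : α → β → List β → γ} (hf : PolyTime f)
    (hg : PolyTime g) (hh : PolyTime fun x : α × β × List β => h x.1 x.2.1 x.2.2) :
    PolyTime fun a => match f a with
      | [] => g a
      | b :: l => h a b l := by
  refine comp (g := fun x : α × List β => match x.2 with
    | [] => g x.1
    | b :: l => h x.1 b l) ?_ (id.pair hf)
  obtain ⟨q, U, hU, hq, c, hc⟩ := hg.comp (fst (β := α) (γ := List β) id)
  obtain ⟨r, W, ⟨w, hw⟩, hr, d, hd⟩ := hh
  refine ⟨.ite (.tl (.var 0)) r q, fun x => 3 + U x + (weight x + 2) ^ w, by fun_prop, ?_,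
    .mono (g := fun x => (weight x + 2) ^ c + (weight x + 2) ^ d) (by fun_prop) ?_⟩
  · rintro ⟨a, - | ⟨b, l⟩⟩
    · exact (Run.ite_false (by simp [Expr.eval, Data.tl]) (hq (a, []))).mono (by
        simp only [Expr.cost]; omega)
    · have time : W (a, b, l) ≤ (weight (a, b :: l) + 2) ^ w := by simpa using hw (a, b, l)
      exact (Run.ite_true (by simp [Expr.eval, Data.tl]) (hr (a, b, l))).mono (by
        simp only [Expr.cost]; omega)
  · rintro ⟨a, - | ⟨b, l⟩⟩
    · exact (hc (a, [])).trans (Nat.le_add_right ..)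
    · refine le_add_of_nonneg_of_le (Nat.zero_le _) ?_
      simpa using hd (a, b, l)

@[fun_prop]
theorem list_headD {f : α → List β} {g : α → β} (hf : PolyTime f) (hg : PolyTime g) :
    PolyTime fun a => (f a).headD (g a) := by
  convert list_cases hf hg (h := fun _ b _ => b) (by fun_prop) with a
  cases f a <;> rfl

end PolyTime

/-- One round of a loop over a list: it turns `(b :: l, a, s)` into `(l, a, s')`, where `p` computes
`s'` from `(a, s, b)`. -/
def Prog.foldBody (p : Prog) : Prog :=
  .pair (.assign 0 (.tl (.hd (.var 0)))) <| .pair (.assign 0 (.hd (.tl (.var 0)))) <| .seq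
    (.assign 0 (.cons (.hd (.tl (.var 0))) (.cons (.tl (.tl (.var 0))) (.hd (.hd (.var 0)))))) p

section

variable {α β γ σ : Type} [Enc α] [Enc β] [Enc γ] [Enc σ]

theorem Run.foldBody {p : Prog} {a : α} {s s' : σ} {b : β} {l : List β} {t : ℕ}
    (h : Run p (enc (a, s, b)) (enc s') t) :
    Run p.foldBody (enc (b :: l, a, s)) (enc (l, a, s')) (t + 75) := by
  have rest := Run.assign (.tl (.hd (.var 0))) (enc (b :: l, a, s))
  have parameter := Run.assign (.hd (.tl (.var 0))) (enc (b :: l, a, s))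
  have arguments := Run.assign
    (.cons (.hd (.tl (.var 0))) (.cons (.tl (.tl (.var 0))) (.hd (.hd (.var 0)))))
    (enc (b :: l, a, s))
  simp only [Expr.eval, initStore_zero, Data.hd, Data.tl, Expr.cost, enc_mk, enc_list_cons]
    at rest parameter arguments h ⊢
  exact (rest.pair (parameter.pair (arguments.seq h))).mono (by omega)

theorem Run.fold {p : Prog} {a : α} {h : σ → β → σ} {S : ℕ} (l : List β) (s : σ)
    (hp : ∀ l₁ b l₂, l = l₁ ++ b :: l₂ →
      Run p (enc (a, l₁.foldl h s, b)) (enc (h (l₁.foldl h s) b)) S) :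
    Run (.loop (.hd (.var 0)) p.foldBody) (enc (l, a, s)) (enc (([] : List β), a, l.foldl h s))
      (l.length * (S + 80) + 3) := by
  induction l generalizing s with
  | nil => exact (Run.loop_false (by simp [Expr.eval, Data.hd])).mono (by simp [Expr.cost])
  | cons b l ih =>
    have round := (hp [] b l rfl).foldBody (l := l)
    have rounds := ih (h s b) fun l₁ c l₂ e => by simpa using hp (b :: l₁) c l₂ (by simp [e])
    refine (Run.loop_true (by simp [Expr.eval, Data.hd]) round rounds).mono ?_
    simp only [Expr.cost, List.length_cons, add_one_mul]
    omega

end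

namespace PolyTime

variable {α β γ σ : Type} [Enc α] [Enc β] [Enc γ] [Enc σ]

theorem foldl {f : α → List β} {g : α → σ} {h : α → σ → β → σ} (hf : PolyTime f) (hg : PolyTime g)
    (hh : PolyTime fun x : α × σ × β => h x.1 x.2.1 x.2.2) {D : α → ℕ} (hD : PolyBounded D)
    (weight_le : ∀ a l, l <+: f a → weight (l.foldl (h a) (g a)) ≤ D a) :
    PolyTime fun a => (f a).foldl (h a) (g a) := by
  suffices PolyTime fun a => (([] : List β), a, (f a).foldl (h a) (g a)) from
    this.snd.snd
  have hfw := hf.polyBounded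
  obtain ⟨p, T, hT, hp, -⟩ : PolyTime fun a => (f a, a, g a) := by fun_prop
  obtain ⟨r, W, ⟨w, hw⟩, hr, -⟩ := hh
  have round_time a (l : List β) b (hl : l ++ [b] <+: f a) :
      W (a, l.foldl (h a) (g a), b) ≤ (weight a + D a + weight (f a) + 4) ^ w := by
    have h₁ := weight_le a l ((List.prefix_append l [b]).trans hl)
    have h₂ := weight_lt_of_mem (hl.subset (by simp : b ∈ l ++ [b]))
    refine (hw _).trans (Nat.pow_le_pow_left ?_ w)
    simp only [weight_mk]
    omega
  refine ⟨p.seq (.loop (.hd (.var 0)) r.foldBody), fun a => T a +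
    (weight (f a) * ((weight a + D a + weight (f a) + 4) ^ w + 80) + 3) + 1, by fun_prop,
    fun a => (hp a).seq ?_, .mono (g := fun a => 1 + (weight a + D a + 1) + 1) (by fun_prop)
      fun a => ?_⟩
  · refine (Run.fold (f a) (g a) fun l₁ b l₂ e => (hr (a, l₁.foldl (h a) (g a), b)).mono
      (round_time a l₁ b ⟨l₂, by simp [e]⟩)).mono ?_
    gcongr
    exact (length_lt_weight (f a)).le
  · have := weight_le a (f a) List.prefix_rfl
    simp only [weight_mk, weight_list_nil]
    omega

theorem foldl_of_weight_le_add {f : α → List β} {g : α → σ} {h : α → σ → β → σ} (hf : PolyTime f)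
    (hg : PolyTime g) (hh : PolyTime fun x : α × σ × β => h x.1 x.2.1 x.2.2) {D : α → ℕ}
    (hD : PolyBounded D) (weight_le : ∀ a s, ∀ b ∈ f a, weight (h a s b) ≤ weight s + D a) :
    PolyTime fun a => (f a).foldl (h a) (g a) := by
  have accumulated a (l : List β) : (∀ b ∈ l, b ∈ f a) → ∀ s,
      weight (l.foldl (h a) s) ≤ weight s + l.length * D a := by
    induction l with
    | nil => simp
    | cons b l ih =>
      intro hl s
      rw [List.forall_mem_cons] at hl
      rw [List.foldl_cons, List.length_cons]
      linarith [ih hl.2 (h a s b), weight_le a s b hl.1]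
  have hfw := hf.polyBounded
  have hgw := hg.polyBounded
  refine foldl hf hg hh (D := fun a => weight (g a) + weight (f a) * D a) (by fun_prop)
    fun a l hl => (accumulated a l (fun b hb => hl.subset hb) (g a)).trans ?_
  gcongr
  exact hl.length_le.trans (length_lt_weight (f a)).le

theorem exists_weight_le_of_mem {f : α → List β} {h : α → β → γ} (hf : PolyTime f)
    (hh : PolyTime fun x : α × β => h x.1 x.2) :
    ∃ D : α → ℕ, PolyBounded D ∧ ∀ a, ∀ b ∈ f a, weight (h a b) ≤ D a := by
  obtain ⟨c, hc⟩ := hh.polyBounded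
  have hfw := hf.polyBounded
  refine ⟨fun a => (weight a + weight (f a) + 3) ^ c, by fun_prop, fun a b hb => ?_⟩
  refine (hc (a, b)).trans (Nat.pow_le_pow_left ?_ c)
  have := weight_lt_of_mem hb
  simp only [weight_mk]
  omega

@[fun_prop]
theorem list_reverse {f : α → List β} (hf : PolyTime f) : PolyTime fun a => (f a).reverse := by
  have hfw := hf.polyBounded
  have : PolyTime fun a => (f a).foldl (fun s b => b :: s) [] :=
    foldl_of_weight_le_add hf (const []) (by fun_prop) (D := fun a => weight (f a) + 1)
      (by fun_prop) fun a s b hb => by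
        have := weight_lt_of_mem hb
        rw [weight_list_cons]
        omega
  simpa using this

@[fun_prop]
theorem list_append {f g : α → List β} (hf : PolyTime f) (hg : PolyTime g) :
    PolyTime fun a => f a ++ g a := by
  have hfw := hf.polyBounded
  have : PolyTime fun a => (f a).reverse.foldl (fun s b => b :: s) (g a) :=
    foldl_of_weight_le_add (by fun_prop) hg (by fun_prop) (D := fun a => weight (f a) + 1)
      (by fun_prop) fun a s b hb => by
        have := weight_lt_of_mem (List.mem_reverse.1 hb)
        rw [weight_list_cons]
        omega
  simpa using this

@[fun_prop]
theorem list_flatMap {f : α → List β} {h : α → β → List γ} (hf : PolyTime f)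
    (hh : PolyTime fun x : α × β => h x.1 x.2) : PolyTime fun a => (f a).flatMap (h a) := by
  obtain ⟨D, hD, weight_le⟩ := exists_weight_le_of_mem hf hh
  simp only [List.flatMap_eq_foldl]
  refine foldl_of_weight_le_add hf (const []) ?_ hD fun a s b hb => ?_
  · exact list_append (by fun_prop) (hh.comp (f := fun x : α × List γ × β => (x.1, x.2.2))
      (by fun_prop))
  · have := weight_list_append s (h a b)
    have := weight_le a b hb
    omega

@[fun_prop]
theorem list_map {f : α → List β} {h : α → β → γ} (hf : PolyTime f)
    (hh : PolyTime fun x : α × β => h x.1 x.2) : PolyTime fun a => (f a).map (h a) := by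
  simp only [List.map_eq_flatMap]
  fun_prop

@[fun_prop]
theorem list_filter {f : α → List β} {h : α → β → Bool} (hf : PolyTime f)
    (hh : PolyTime fun x : α × β => h x.1 x.2) : PolyTime fun a => (f a).filter (h a) := by
  have flatMap_ite a (l : List β) :
      (l.flatMap fun b => if h a b then [b] else []) = l.filter (h a) := by
    induction l with
    | nil => rfl
    | cons b l ih => rw [List.flatMap_cons, ih, List.filter_cons]; split_ifs <;> rfl
  simp only [← flatMap_ite]
  fun_prop

@[fun_prop]
theorem bool_not {f : α → Bool} (hf : PolyTime f) : PolyTime fun a => !f a := by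
  have : PolyTime fun a => if f a then false else true := by fun_prop
  simpa using this

@[fun_prop]
theorem bool_and {f g : α → Bool} (hf : PolyTime f) (hg : PolyTime g) :
    PolyTime fun a => f a && g a := by
  have : PolyTime fun a => if f a then g a else false := by fun_prop
  simpa using this

@[fun_prop]
theorem bool_or {f g : α → Bool} (hf : PolyTime f) (hg : PolyTime g) :
    PolyTime fun a => f a || g a := by
  have : PolyTime fun a => if f a then true else g a := by fun_prop
  simpa using this

@[fun_prop]
theorem list_isEmpty {f : α → List β} (hf : PolyTime f) : PolyTime fun a => (f a).isEmpty :=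
  list_cases hf (const true) (const false)

@[fun_prop]
theorem list_any {f : α → List β} {h : α → β → Bool} (hf : PolyTime f)
    (hh : PolyTime fun x : α × β => h x.1 x.2) : PolyTime fun a => (f a).any (h a) := by
  have any_eq a : (f a).any (h a) = !((f a).filter (h a)).isEmpty := by
    rw [Bool.eq_iff_iff]
    simp
  simp only [any_eq]
  fun_prop

@[fun_prop]
theorem list_all {f : α → List β} {h : α → β → Bool} (hf : PolyTime f)
    (hh : PolyTime fun x : α × β => h x.1 x.2) : PolyTime fun a => (f a).all (h a) := by
  simp only [List.all_eq_not_any_not]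
  fun_prop

@[fun_prop]
theorem list_length {f : α → List β} (hf : PolyTime f) : PolyTime fun a => (f a).length := by
  have length_unit : PolyTime (List.length : List Unit → ℕ) :=
    of_enc_eq (fun l => (enc_list_unit l).symm) fun l => (weight_list_unit l).ge
  have : PolyTime fun a => ((f a).map fun _ => ()).length := by fun_prop
  simpa using this

@[fun_prop]
theorem replicate_unit {f : α → ℕ} (hf : PolyTime f) : PolyTime fun a => List.replicate (f a) () :=
  comp (g := fun n : ℕ => List.replicate n ())
    (of_enc_eq (fun n => by rw [enc_list_unit, List.length_replicate])
      fun n => by rw [weight_list_unit, List.length_replicate, weight_nat]) hf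

@[fun_prop]
theorem nat_add {f g : α → ℕ} (hf : PolyTime f) (hg : PolyTime g) :
    PolyTime fun a => f a + g a := by
  have : PolyTime fun a => (List.replicate (f a) () ++ List.replicate (g a) ()).length := by
    fun_prop
  simpa using this

@[fun_prop]
theorem list_drop {f : α → List β} {g : α → ℕ} (hf : PolyTime f) (hg : PolyTime g) :
    PolyTime fun a => (f a).drop (g a) := by
  have foldl_tail (n : ℕ) (l : List β) :
      (List.replicate n ()).foldl (fun s _ => s.tail) l = l.drop n := by
    induction n generalizing l with
    | zero => simp
    | succ n ih => rw [List.replicate_succ, List.foldl_cons, ih, ← List.drop_one, List.drop_drop,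
        add_comm]
  have : PolyTime fun a => (List.replicate (g a) ()).foldl (fun s _ => s.tail) (f a) :=
    foldl_of_weight_le_add (by fun_prop) hf (by fun_prop) (.const 0) fun a s _ _ => by
      cases s <;> simp; omega
  simpa only [foldl_tail] using this

@[fun_prop]
theorem list_getD {f : α → List β} {g : α → ℕ} {h : α → β} (hf : PolyTime f) (hg : PolyTime g)
    (hh : PolyTime h) : PolyTime fun a => (f a).getD (g a) (h a) := by
  have : PolyTime fun a => ((f a).drop (g a)).headD (h a) := by fun_prop
  simpa [List.headD_eq_head?_getD, List.getD_eq_getElem?_getD] using this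

@[fun_prop]
theorem nat_sub {f g : α → ℕ} (hf : PolyTime f) (hg : PolyTime g) :
    PolyTime fun a => f a - g a := by
  have : PolyTime fun a => ((List.replicate (f a) ()).drop (g a)).length := by fun_prop
  simpa using this

@[fun_prop]
theorem nat_eq_zero {f : α → ℕ} (hf : PolyTime f) : PolyTime fun a => decide (f a = 0) := by
  have : PolyTime fun a => (List.replicate (f a) ()).isEmpty := by fun_prop
  simpa using this

@[fun_prop]
theorem nat_le {f g : α → ℕ} (hf : PolyTime f) (hg : PolyTime g) :
    PolyTime fun a => decide (f a ≤ g a) := by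
  have : PolyTime fun a => decide (f a - g a = 0) := by fun_prop
  simpa only [Nat.sub_eq_zero_iff_le] using this

@[fun_prop]
theorem nat_eq {f g : α → ℕ} (hf : PolyTime f) (hg : PolyTime g) :
    PolyTime fun a => decide (f a = g a) := by
  have : PolyTime fun a => decide (f a ≤ g a) && decide (g a ≤ f a) := by fun_prop
  simpa only [← Bool.decide_and, ← le_antisymm_iff] using this

@[fun_prop]
theorem list_range {f : α → ℕ} (hf : PolyTime f) : PolyTime fun a => List.range (f a) := by
  have foldl_append_length (n : ℕ) :
      (List.replicate n ()).foldl (fun s _ => s ++ [s.length]) [] = List.range n := by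
    induction n with
    | zero => simp
    | succ n ih => rw [List.replicate_succ', List.foldl_append, ih, List.range_succ]; simp
  have hfw := hf.polyBounded
  have : PolyTime fun a => (List.replicate (f a) ()).foldl (fun s _ => s ++ [s.length]) [] := by
    refine foldl (D := fun a => weight (f a) * (weight (f a) + 1) + 1) (by fun_prop) (const [])
      (by fun_prop) (by fun_prop) fun a l hl => ?_
    obtain ⟨hm, hl⟩ := List.prefix_replicate_iff.1 hl
    rw [hl, foldl_append_length]
    refine (weight_list_le (m := weight (f a)) fun b hb => ?_).trans ?_
    · have := List.mem_range.1 hb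
      simp only [weight_nat]
      omega
    · rw [List.length_range]
      gcongr
      simp only [weight_nat]
      omega
  simpa only [foldl_append_length] using this

theorem fin_all {d : ℕ} {b : Fin d → α → Bool} (h : ∀ j, PolyTime (b j)) :
    PolyTime fun a => decide (∀ j, b j a = true) := by
  induction d with
  | zero => simpa using const true
  | succ d ih =>
    have := bool_and (h 0) (ih fun j => h j.succ)
    simpa [Fin.forall_fin_succ] using this

theorem fin_any {d : ℕ} {b : Fin d → α → Bool} (h : ∀ j, PolyTime (b j)) :
    PolyTime fun a => decide (∃ j, b j a = true) := by
  have := bool_not (fin_all fun j => bool_not (h j))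
  simpa [← decide_not] using this

end PolyTime

/-! ## Programs for computable functions -/

open Turing.ToPartrec

theorem hd_enc_list (v : List ℕ) : (enc v).hd = enc v.headI := by cases v <;> rfl

theorem tl_enc_list {α : Type} [Enc α] (v : List α) : (enc v).tl = enc v.tail := by
  cases v <;> rfl

theorem tl_enc_succ (n : ℕ) : (enc (n + 1)).tl = enc n := rfl

theorem enc_nat_eq_nil {n : ℕ} : enc n = Data.nil ↔ n = 0 := by cases n <;> simp

namespace Prog

/-- Replaces the input by its left subtree: the head of a list. -/
def head : Prog := assign 0 (.hd (.var 0))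

/-- Replaces the input by its right subtree: the tail of a list. -/
def tail : Prog := assign 0 (.tl (.var 0))

/-- Iterates `p` while the output is a list with positive head, passing on its tail. -/
def fix (p : Prog) : Prog := seq p <| seq (loop (.hd (.var 0)) (seq tail p)) tail

end Prog

theorem Run.head (v : List ℕ) : Run .head (enc v) (enc v.headI) 3 := by
  simpa [Prog.head, Expr.eval, Expr.cost, hd_enc_list] using Run.assign (.hd (.var 0)) (enc v)

theorem Run.tail (v : List ℕ) : Run .tail (enc v) (enc v.tail) 3 := by
  simpa [Prog.tail, Expr.eval, Expr.cost, tl_enc_list] using Run.assign (.tl (.var 0)) (enc v)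

theorem eval_head_eq_nil {v : List ℕ} :
    (Expr.hd (.var 0)).eval (initStore (enc v)) = .nil ↔ v.headI = 0 := by
  rw [Expr.eval, Expr.eval, initStore_zero, hd_enc_list, enc_nat_eq_nil]

/-- The program `p` computes the partial function `f`, and `E` is a partial recursive function that
returns the value of `f` together with a bound on the running time of `p`. -/
def ComputesIn (p : Prog) (f : List ℕ →. List ℕ) (E : List ℕ →. List ℕ × ℕ) : Prop :=
  Partrec E ∧ ∀ v w, w ∈ f v → ∃ t, (w, t) ∈ E v ∧ Run p (enc v) (enc w) t

namespace ComputesIn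

variable {p q : Prog} {f g : List ℕ →. List ℕ} {E F : List ℕ →. List ℕ × ℕ}

theorem of_expr {e : Expr} {g : List ℕ → List ℕ} (hg : Computable g)
    (he : ∀ v, e.eval (initStore (enc v)) = enc (g v)) :
    ComputesIn (.assign 0 e) (fun v => pure (g v)) (fun v => Part.some (g v, e.cost + 1)) := by
  refine ⟨(hg.pair (Computable.const _)).partrec, fun v w hw => ?_⟩
  obtain rfl := Part.mem_some_iff.1 hw
  exact ⟨_, Part.mem_some _, he v ▸ Run.assign e (enc v)⟩

theorem cons (hp : ComputesIn p f E) (hq : ComputesIn q g F) :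
    ComputesIn (.pair (.seq p .head) q)
      (fun v => (f v).bind fun n => (g v).bind fun ns => Part.some (n.headI :: ns))
      (fun v => (E v).bind fun x => (F v).map fun y => (x.1.headI :: y.1, x.2 + y.2 + 40)) := by
  refine ⟨?_, fun v w hw => ?_⟩
  · refine hp.1.bind (.map (hq.1.comp Computable.fst) (Primrec.to_comp ?_))
    refine .pair (Primrec.list_cons.comp (Primrec.list_headI.comp ?_) ?_)
      (Primrec.nat_add.comp (Primrec.nat_add.comp ?_ ?_) (.const 40))
    · exact Primrec.fst.comp (Primrec.snd.comp Primrec.fst)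
    · exact Primrec.fst.comp Primrec.snd
    · exact Primrec.snd.comp (Primrec.snd.comp Primrec.fst)
    · exact Primrec.snd.comp Primrec.snd
  · simp only [Part.mem_bind_iff, Part.mem_some_iff] at hw
    obtain ⟨n, hn, ns, hns, rfl⟩ := hw
    obtain ⟨t, ht, run_p⟩ := hp.2 v n hn
    obtain ⟨u, hu, run_q⟩ := hq.2 v ns hns
    exact ⟨t + u + 40, Part.mem_bind ht (Part.mem_map _ hu),
      ((run_p.seq (.head n)).pair run_q).mono (by omega)⟩

theorem comp (hp : ComputesIn p f E) (hq : ComputesIn q g F) :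
    ComputesIn (.seq q p) (fun v => (g v).bind f)
      (fun v => (F v).bind fun x => (E x.1).map fun y => (y.1, x.2 + y.2 + 1)) := by
  refine ⟨?_, fun v w hw => ?_⟩
  · refine hq.1.bind (.map (hp.1.comp (Computable.fst.comp Computable.snd)) (Primrec.to_comp ?_))
    refine .pair ?_ (Primrec.nat_add.comp (Primrec.nat_add.comp ?_ ?_) (.const 1))
    · exact Primrec.fst.comp Primrec.snd
    · exact Primrec.snd.comp (Primrec.snd.comp Primrec.fst)
    · exact Primrec.snd.comp Primrec.snd
  · obtain ⟨y, hy, hw⟩ := Part.mem_bind_iff.1 hw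
    obtain ⟨t, ht, run_q⟩ := hq.2 v y hy
    obtain ⟨u, hu, run_p⟩ := hp.2 y w hw
    exact ⟨t + u + 1, Part.mem_bind ht (Part.mem_map _ hu), run_q.seq run_p⟩

/-- The running time of the program for `Code.case`, given those of its branches. -/
def caseTime (E F : List ℕ →. List ℕ × ℕ) : List ℕ →. List ℕ × ℕ := fun v =>
  (bif decide (v.headI = 0) then E v.tail else F ((v.headI - 1) :: v.tail)).map
    fun x => (x.1, x.2 + 20)

theorem partrec_caseTime (hE : Partrec E) (hF : Partrec F) : Partrec (caseTime E F) := by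
  refine .map (.cond ?_ (hE.comp Primrec.list_tail.to_comp) (hF.comp ?_)) ?_
  · exact (Primrec.eq.comp Primrec.list_headI (.const 0)).decide.to_comp
  · exact (Primrec.list_cons.comp (Primrec.nat_sub.comp Primrec.list_headI (.const 1))
      Primrec.list_tail).to_comp
  · exact Primrec.to_comp (.pair (Primrec.fst.comp Primrec.snd)
      (Primrec.nat_add.comp (Primrec.snd.comp Primrec.snd) (.const 20)))

theorem case (hp : ComputesIn p f E) (hq : ComputesIn q g F) :
    ComputesIn (.ite (.hd (.var 0))
        (.seq (.assign 0 (.cons (.tl (.hd (.var 0))) (.tl (.var 0)))) q) (.seq .tail p))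
      (fun v => v.headI.rec (f v.tail) fun y _ => g (y :: v.tail)) (caseTime E F) := by
  refine ⟨partrec_caseTime hp.1 hq.1, fun v w hw => ?_⟩
  unfold caseTime
  cases hv : v.headI with
  | zero =>
    simp only [hv] at hw
    obtain ⟨t, ht, run_p⟩ := hp.2 _ w hw
    exact ⟨t + 20, Part.mem_map (fun x => (x.1, x.2 + 20)) ht,
      (Run.ite_false (eval_head_eq_nil.2 hv) ((Run.tail v).seq run_p)).mono
        (by simp only [Expr.cost]; omega)⟩
  | succ n =>
    simp only [hv] at hw
    obtain ⟨t, ht, run_q⟩ := hq.2 _ w hw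
    have pred : Run (.assign 0 (.cons (.tl (.hd (.var 0))) (.tl (.var 0)))) (enc v)
        (enc (n :: v.tail)) 7 := by
      simpa [Expr.eval, Expr.cost, hd_enc_list, tl_enc_list, hv, tl_enc_succ, -enc_succ] using
        Run.assign (.cons (.tl (.hd (.var 0))) (.tl (.var 0))) (enc v)
    exact ⟨t + 20, Part.mem_map (fun x => (x.1, x.2 + 20)) ht,
      (Run.ite_true (by simp [eval_head_eq_nil, hv]) (pred.seq run_q)).mono
        (by simp only [Expr.cost]; omega)⟩

/-- The step iterated by `Code.fix`: the next input is the tail of the output, and a zero at the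
head of the output ends the iteration. -/
def fixStep (f : List ℕ →. List ℕ) : List ℕ →. List ℕ ⊕ List ℕ := fun v =>
  (f v).map fun v => if v.headI = 0 then .inl v.tail else .inr v.tail

/-- `fixStep` with a second component that accumulates the running time. -/
def timedFixStep (E : List ℕ →. List ℕ × ℕ) : List ℕ × ℕ →. (List ℕ × ℕ) ⊕ (List ℕ × ℕ) :=
  fun x => (E x.1).map fun y =>
    bif decide (y.1.headI = 0) then .inl (y.1.tail, x.2 + y.2 + 20)
    else .inr (y.1.tail, x.2 + y.2 + 20)

theorem partrec_timedFixStep (hE : Partrec E) : Partrec (timedFixStep E) := by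
  have next : Primrec fun z : (List ℕ × ℕ) × (List ℕ × ℕ) => (z.2.1.tail, z.1.2 + z.2.2 + 20) :=
    .pair (Primrec.list_tail.comp (Primrec.fst.comp Primrec.snd))
      (Primrec.nat_add.comp (Primrec.nat_add.comp (Primrec.snd.comp Primrec.fst)
        (Primrec.snd.comp Primrec.snd)) (.const 20))
  refine .map (hE.comp Computable.fst) (Primrec.to_comp ?_)
  exact .cond (Primrec.eq.comp (Primrec.list_headI.comp (Primrec.fst.comp Primrec.snd))
    (.const 0)).decide (Primrec.sumInl.comp next) (Primrec.sumInr.comp next)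

/-- The time of the iteration is bounded by the number `T` that `timedFixStep` accumulates. The
output `y` of the first call of `p` is named because the loop starts from it. -/
def FixTrace (p : Prog) (E : List ℕ →. List ℕ × ℕ) (w v : List ℕ) : Prop :=
  ∃ (y z : List ℕ) (t u T : ℕ), Run p (enc v) (enc y) t ∧
    Run (.loop (.hd (.var 0)) (.seq .tail p)) (enc y) (enc z) u ∧
    z.tail = w ∧ t + u ≤ T ∧ ∀ acc, (w, acc + T) ∈ PFun.fix (timedFixStep E) (v, acc)

theorem fixTrace (hp : ComputesIn p f E) {v w : List ℕ} (hw : w ∈ PFun.fix (fixStep f) v) :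
    FixTrace p E w v := by
  refine PFun.fixInduction hw fun v hv ih => ?_
  obtain ⟨y, hy⟩ : ∃ y, y ∈ f v :=
    ⟨(f v).get (PFun.dom_of_mem_fix hv), Part.get_mem _⟩
  obtain ⟨t, ht, run_p⟩ := hp.2 v y hy
  by_cases h0 : y.headI = 0
  · have halted : Sum.inl y.tail ∈ fixStep f v :=
      (Part.mem_map_iff _).2 ⟨y, hy, by simp [h0]⟩
    obtain rfl : y.tail = w := Part.mem_unique (PFun.fix_stop halted) hv
    refine ⟨y, y, t, _, t + 20, run_p, Run.loop_false (eval_head_eq_nil.2 h0), rfl,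
      by simp [Expr.cost], fun acc => PFun.fix_stop ((Part.mem_map_iff _).2 ⟨_, ht, ?_⟩)⟩
    simp [h0, add_assoc]
  · have step : Sum.inr y.tail ∈ fixStep f v :=
      (Part.mem_map_iff _).2 ⟨y, hy, by simp [h0]⟩
    obtain ⟨y', z, t', u, T, run_p', run_loop, hz, hT, hfix⟩ := ih y.tail step
    refine ⟨y, z, t, _, t + 20 + T, run_p,
      Run.loop_true (eval_head_eq_nil.not.2 h0) ((Run.tail y).seq run_p') run_loop, hz,
      by simp only [Expr.cost]; omega, fun acc => ?_⟩
    have timed_step : Sum.inr (y.tail, acc + t + 20) ∈ timedFixStep E (v, acc) :=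
      (Part.mem_map_iff _).2 ⟨_, ht, by simp [h0]⟩
    rw [PFun.fix_fwd_eq timed_step]
    simpa only [add_assoc] using hfix (acc + t + 20)

theorem fix (hp : ComputesIn p f E) :
    ComputesIn p.fix (PFun.fix (fixStep f))
      (fun v => (PFun.fix (timedFixStep E) (v, 0)).map fun x => (x.1, x.2 + 20)) := by
  refine ⟨?_, fun v w hw => ?_⟩
  · refine .map ((partrec_timedFixStep hp.1).fix.comp
      (Primrec.pair .id (.const 0)).to_comp) (Primrec.to_comp ?_)
    exact .pair (Primrec.fst.comp Primrec.snd)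
      (Primrec.nat_add.comp (Primrec.snd.comp Primrec.snd) (.const 20))
  · obtain ⟨y, z, t, u, T, run_p, run_loop, rfl, hT, hfix⟩ := hp.fixTrace hw
    exact ⟨T + 20, (Part.mem_map_iff _).2 ⟨_, hfix 0, by simp⟩,
      (run_p.seq (run_loop.seq (Run.tail z))).mono (by omega)⟩

end ComputesIn

theorem exists_computesIn (c : Code) : ∃ p E, ComputesIn p c.eval E := by
  induction c with
  | zero' =>
    rw [Code.zero'_eval]
    exact ⟨_, _, ComputesIn.of_expr (e := .cons .nil (.var 0))
      (Primrec.list_cons.comp (.const 0) .id).to_comp fun v => by simp [Expr.eval]⟩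
  | succ =>
    rw [Code.succ_eval]
    exact ⟨_, _, ComputesIn.of_expr (e := .cons (.cons .nil (.hd (.var 0))) .nil)
      (Primrec.list_cons.comp (Primrec.succ.comp Primrec.list_headI) (.const [])).to_comp
      fun v => by simp [Expr.eval, hd_enc_list]⟩
  | tail =>
    rw [Code.tail_eval]
    exact ⟨_, _, ComputesIn.of_expr (e := .tl (.var 0)) Primrec.list_tail.to_comp
      fun v => by simp [Expr.eval, tl_enc_list]⟩
  | cons f fs ihf ihfs =>
    obtain ⟨p, E, hp⟩ := ihf
    obtain ⟨q, F, hq⟩ := ihfs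
    rw [Code.cons_eval]
    exact ⟨_, _, hp.cons hq⟩
  | comp f g ihf ihg =>
    obtain ⟨p, E, hp⟩ := ihf
    obtain ⟨q, F, hq⟩ := ihg
    rw [Code.comp_eval]
    exact ⟨_, _, hp.comp hq⟩
  | case f g ihf ihg =>
    obtain ⟨p, E, hp⟩ := ihf
    obtain ⟨q, F, hq⟩ := ihg
    rw [Code.case_eval]
    exact ⟨_, _, hp.case hq⟩
  | fix f ih =>
    obtain ⟨p, E, hp⟩ := ih
    rw [Code.fix_eval]
    exact ⟨_, _, hp.fix⟩

theorem exists_run_of_computable {s : ℕ → ℕ} (hs : Computable s) :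
    ∃ (p : Prog) (T : ℕ → ℕ), Computable T ∧ ∀ k, Run p (enc k) (enc (s k)) (T k) := by
  obtain ⟨c, hc⟩ := Code.exists_code
    (Nat.Partrec'.part_iff₁.2 hs.partrec : Nat.Partrec' fun v : List.Vector ℕ 1 => s v.head)
  obtain ⟨p, E, hE, hp⟩ := exists_computesIn c
  have eval_c (k : ℕ) : [s k] ∈ c.eval [k] := by
    have h : c.eval [k] = _ := hc ⟨[k], rfl⟩
    simp [h, List.Vector.head]
  choose T hT run_p using fun k => hp [k] [s k] (eval_c k)
  have computable_T : Computable T := by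
    have h : Partrec fun k => (E [k]).map Prod.snd :=
      .map (hE.comp (Primrec.list_cons.comp .id (.const [])).to_comp)
        (Computable.snd.comp Computable.snd)
    exact h.of_eq fun k => Part.eq_some_iff.2 ((Part.mem_map_iff _).2 ⟨_, hT k, rfl⟩)
  refine ⟨.seq (.assign 0 (.cons (.var 0) .nil)) (.seq p .head), fun k => T k + 20,
    (Primrec.nat_add.comp .id (.const 20)).to_comp.comp computable_T, fun k => ?_⟩
  have singleton : Run (.assign 0 (.cons (.var 0) .nil)) (enc k) (enc [k]) 4 := by
    simpa [Expr.eval, Expr.cost] using Run.assign (.cons (.var 0) .nil) (enc k)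
  exact (singleton.seq ((run_p k).seq (.head [s k]))).mono (by dsimp only; omega)

/-! ## Connected sets and vertex deletion -/

section Connected

variable {V W ι : Type}

theorem reachable_propagate {G : SimpleGraph V} {P : V → Prop}
    (h : ∀ u v, G.Adj u v → P u → P v) {u v : V} (r : G.Reachable u v) (hu : P u) : P v := by
  obtain ⟨p⟩ := r
  induction p with
  | nil => exact hu
  | cons hadj _ ih => exact ih (h _ _ hadj hu)

theorem connected_propagate {G : SimpleGraph V} {S : Set V} (hS : (G.induce S).Connected)
    {P : V → Prop} (h : ∀ u ∈ S, ∀ v ∈ S, G.Adj u v → P u → P v) {u v : V} (hu : u ∈ S) (hv : v ∈ S)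
    (hP : P u) : P v :=
  reachable_propagate (G := G.induce S) (P := fun x => P x.1)
    (fun x y hxy => h x.1 x.2 y.1 y.2 hxy) (hS.preconnected ⟨u, hu⟩ ⟨v, hv⟩) hP

theorem GraphClass.mem_of_embedding {Γ : GraphClass} (hΓ : Γ.IsHereditary) [Finite V]
    [Finite W] {H : SimpleGraph V} {G : SimpleGraph W} (f : H ↪g G) (hG : Γ.Mem G) : Γ.Mem H :=
  Γ.mem_of_iso _ _ ⟨f.isoInduceRange.symm⟩ (hΓ G _ hG)

theorem GraphClass.mem_induce_of_subset {Γ : GraphClass} (hΓ : Γ.IsHereditary)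
    [Finite V] {G : SimpleGraph V} {S T : Set V} (hST : S ⊆ T) (hT : Γ.Mem (G.induce T)) :
    Γ.Mem (G.induce S) :=
  GraphClass.mem_of_embedding hΓ (SimpleGraph.induceHomOfLE G hST) hT

/-- An embedding identifies each induced subgraph with the one induced by the image. -/
noncomputable def induceImageIso {H : SimpleGraph V} {G : SimpleGraph W} (f : H ↪g G) (S : Set V) :
    H.induce S ≃g G.induce (f '' S) :=
  ⟨Equiv.Set.image f S f.injective, by simp⟩

/-- Every connected subset of `X` induces a member of one of the classes. For hereditary classes
this says that the components of `G.induce X` are in the classes, without passing to the type of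
vertices of an induced subgraph. -/
def ConnectedIn (Γ : ι → GraphClass) [Finite V] (G : SimpleGraph V) (X : Set V) : Prop :=
  ∀ S ⊆ X, (G.induce S).Connected → ∃ i, (Γ i).Mem (G.induce S)

theorem ConnectedIn.mono {Γ : ι → GraphClass} [Finite V] {G : SimpleGraph V}
    {X Y : Set V} (h : ConnectedIn Γ G Y) (hXY : X ⊆ Y) : ConnectedIn Γ G X :=
  fun S hS => h S (hS.trans hXY)

theorem subset_supp_of_connected {H : SimpleGraph V} {S : Set V} (hS : (H.induce S).Connected)
    {v : V} (hv : v ∈ S) : S ⊆ (H.connectedComponentMk v).supp := fun u hu =>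
  SimpleGraph.ConnectedComponent.sound <|
    (hS.preconnected ⟨u, hu⟩ ⟨v, hv⟩).map (SimpleGraph.Embedding.induce S).toHom

theorem componentsIn_iff {Γ : ι → GraphClass} (hΓ : ∀ i, (Γ i).IsHereditary) [Finite V]
    [Finite W] {H : SimpleGraph V} {G : SimpleGraph W} (f : H ↪g G) :
    ComponentsIn Γ H ↔ ConnectedIn Γ G (Set.range f) := by
  constructor
  · intro h S hS hc
    obtain ⟨S, rfl⟩ := Set.subset_range_iff_exists_image_eq.1 hS
    rw [← (induceImageIso f S).connected_iff] at hc
    obtain ⟨v⟩ := hc.nonempty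
    obtain ⟨i, hi⟩ := h (H.connectedComponentMk v)
    exact ⟨i, GraphClass.mem_of_embedding (hΓ i) (induceImageIso f S).symm.toEmbedding
      (GraphClass.mem_induce_of_subset (hΓ i) (subset_supp_of_connected hc v.2) hi)⟩
  · intro h C
    obtain ⟨i, hi⟩ := h (f '' C.supp) (Set.image_subset_range _ _)
      ((induceImageIso f C.supp).connected_iff.1 C.connected_toSimpleGraph)
    exact ⟨i, GraphClass.mem_of_embedding (hΓ i) (induceImageIso f C.supp).toEmbedding hi⟩

theorem componentsIn_induce_comap_iff {Γ : ι → GraphClass} (hΓ : ∀ i, (Γ i).IsHereditary)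
    [Finite V] [Finite W] (G : SimpleGraph W) (f : V ↪ W) (S : Set V) :
    ComponentsIn Γ ((G.comap f).induce S) ↔ ConnectedIn Γ G (f '' S) := by
  rw [componentsIn_iff hΓ
    ((SimpleGraph.Embedding.comap f G).comp (SimpleGraph.Embedding.induce S))]
  have range_eq : Set.range ((SimpleGraph.Embedding.comap f G).comp
      (SimpleGraph.Embedding.induce (G := G.comap f) S)) = f '' S :=
    (Set.range_comp f Subtype.val).trans (by rw [Subtype.range_coe])
  rw [range_eq]

theorem vertexDeletion_comap_iff {Γ : ι → GraphClass} (hΓ : ∀ i, (Γ i).IsHereditary)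
    {n m : ℕ} (G : SimpleGraph (Fin n)) (f : Fin m ↪ Fin n) (k : ℕ) :
    VertexDeletion Γ m (G.comap f) k ↔
      ∃ Z : Finset (Fin n), Z.card ≤ k ∧ ConnectedIn Γ G (Set.range f \ Z) := by
  simp only [VertexDeletion, componentsIn_induce_comap_iff hΓ]
  constructor
  · rintro ⟨Z, hZ, h⟩
    refine ⟨Z.map f, by simpa using hZ, h.mono ?_⟩
    rintro _ ⟨⟨v, rfl⟩, hv⟩
    exact ⟨v, by simpa using hv, rfl⟩
  · rintro ⟨Z, hZ, h⟩
    refine ⟨Z.preimage f f.injective.injOn, le_trans ?_ hZ, h.mono ?_⟩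
    · exact Finset.card_le_card_of_injOn f (by simp [Set.MapsTo]) f.injective.injOn
    · rintro _ ⟨v, hv, rfl⟩
      exact ⟨⟨v, rfl⟩, by simpa using hv⟩

theorem vertexDeletion_iff {Γ : ι → GraphClass} (hΓ : ∀ i, (Γ i).IsHereditary)
    {n : ℕ} (G : SimpleGraph (Fin n)) (k : ℕ) :
    VertexDeletion Γ n G k ↔
      ∃ Z : Finset (Fin n), Z.card ≤ k ∧ ConnectedIn Γ G (Z : Set (Fin n))ᶜ := by
  have range_refl : Set.range (Function.Embedding.refl (Fin n)) = Set.univ := Set.range_id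
  simp only [Set.compl_eq_univ_sdiff, ← range_refl]
  exact vertexDeletion_comap_iff hΓ G (Function.Embedding.refl _) k

end Connected

/-! ## Labellings -/

section Labelling

open scoped Finset

variable {V ι : Type}

/-- A labelling of the vertices as deleted (`none`) or by one of the classes, such that vertices
with different classes are not adjacent and every class contains the connected sets labelled by
it. -/
structure IsSolution (Γ : ι → GraphClass) [Fintype V] (G : SimpleGraph V) (k : ℕ)
    (lab : V → Option ι) : Prop where
  card_le : #{v | lab v = none} ≤ k
  adj : ∀ u v, G.Adj u v → lab u = none ∨ lab v = none ∨ lab u = lab v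
  mem : ∀ j, ConnectedIn (fun _ : Unit => Γ j) G {v | lab v = some j}

theorem IsSolution.vertexDeletion {Γ : ι → GraphClass} (hΓ : ∀ i, (Γ i).IsHereditary) {n : ℕ}
    {G : SimpleGraph (Fin n)} {k : ℕ} {lab : Fin n → Option ι} (h : IsSolution Γ G k lab) :
    VertexDeletion Γ n G k := by
  refine (vertexDeletion_iff hΓ G k).2 ⟨_, h.card_le, fun S hS hc => ?_⟩
  have ne_none (u : Fin n) (hu : u ∈ S) : lab u ≠ none := by simpa using hS hu
  obtain ⟨v, hv⟩ := hc.nonempty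
  obtain ⟨j, hj⟩ := Option.ne_none_iff_exists'.1 (ne_none v hv)
  have lab_eq (u : Fin n) (hu : u ∈ S) : lab u = some j := by
    refine connected_propagate hc (P := fun u => lab u = some j) (fun u hu w hw hadj hP => ?_)
      hv hu hj
    rcases h.adj u w hadj with h | h | h
    · exact absurd h (ne_none u hu)
    · exact absurd h (ne_none w hw)
    · rwa [← h]
  obtain ⟨_, hmem⟩ := h.mem j S lab_eq hc
  exact ⟨j, hmem⟩

/-- The graph with the edges at the vertices of `Z` removed. Its components are those of `G - Z`
and the vertices of `Z`. -/
def isolate (G : SimpleGraph V) (Z : Set V) : SimpleGraph V where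
  Adj u v := G.Adj u v ∧ u ∉ Z ∧ v ∉ Z
  symm := ⟨fun _ _ h => ⟨h.1.symm, h.2.2, h.2.1⟩⟩
  loopless := ⟨fun _ h => h.1.ne rfl⟩

section Isolate

variable {G : SimpleGraph V} {Z : Set V}

theorem notMem_of_mem_supp_isolate {u v : V} (hv : v ∉ Z)
    (hu : u ∈ ((isolate G Z).connectedComponentMk v).supp) : u ∉ Z :=
  reachable_propagate (G := isolate G Z) (P := (· ∉ Z)) (fun _ _ hadj _ => hadj.2.2)
    (SimpleGraph.ConnectedComponent.exact hu).symm hv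

theorem connected_induce_supp_isolate (C : (isolate G Z).ConnectedComponent) :
    (G.induce C.supp).Connected :=
  C.connected_toSimpleGraph.mono fun _ _ hadj => And.left hadj

theorem induce_isolate {S : Set V} (hS : S ⊆ Zᶜ) :
    (isolate G Z).induce S = G.induce S := by
  ext u v
  exact and_iff_left ⟨hS u.2, hS v.2⟩

end Isolate

/-- `X` is a union of components of `G - Z`. -/
structure IsComponentUnion (G : SimpleGraph V) (Z X : Finset V) : Prop where
  disjoint : Disjoint X Z
  mem_of_adj : ∀ u ∈ X, ∀ v ∉ Z, G.Adj u v → v ∈ X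

namespace IsComponentUnion

variable {G : SimpleGraph V} {Z X Y : Finset V}

theorem empty : IsComponentUnion G Z ∅ := ⟨by simp, by simp⟩

theorem union [DecidableEq V] (hX : IsComponentUnion G Z X) (hY : IsComponentUnion G Z Y) :
    IsComponentUnion G Z (X ∪ Y) where
  disjoint := Finset.disjoint_union_left.2 ⟨hX.disjoint, hY.disjoint⟩
  mem_of_adj u hu v hv hadj := Finset.mem_union.2 <| (Finset.mem_union.1 hu).imp
    (hX.mem_of_adj u · v hv hadj) (hY.mem_of_adj u · v hv hadj)

theorem supp [Fintype V] {v : V} [DecidablePred (· ∈ ((isolate G Z).connectedComponentMk v).supp)]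
    (hv : v ∉ Z) :
    IsComponentUnion G Z {u | u ∈ ((isolate G Z).connectedComponentMk v).supp} where
  disjoint := Finset.disjoint_left.2 fun _ hu =>
    notMem_of_mem_supp_isolate hv (Finset.mem_filter.1 hu).2
  mem_of_adj u hu w hw hadj := by
    rw [Finset.mem_filter_univ] at hu ⊢
    exact SimpleGraph.ConnectedComponent.mem_supp_of_adj_mem_supp _ hu
      ⟨hadj, notMem_of_mem_supp_isolate hv hu, hw⟩

theorem card_lt_or_card_compl_lt {n s k : ℕ} {G : SimpleGraph (Fin n)} {Z X : Finset (Fin n)}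
    (hX : IsComponentUnion G Z X) (hG : IsUnbreakable G s k) (hZ : #Z ≤ k) :
    #X < s ∨ #(Xᶜ \ Z) < s := by
  by_contra! hcon
  refine hG ⟨X, Z, Xᶜ \ Z, ?_, hX.disjoint, ?_, Finset.disjoint_sdiff, fun u hu v hv hadj => ?_,
    hZ, hcon.1, hcon.2⟩
  · ext v
    simp only [Finset.mem_union, Finset.mem_sdiff, Finset.mem_compl, Finset.mem_univ]
    tauto
  · exact disjoint_compl_right.mono_right Finset.sdiff_subset
  · simp only [Finset.mem_sdiff, Finset.mem_compl] at hv
    exact hv.1 (hX.mem_of_adj u hu v hv.2 hadj)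

end IsComponentUnion

open Classical in
theorem card_compl_le_of_forall_card_supp_le {n s k : ℕ} {G : SimpleGraph (Fin n)}
    (hG : IsUnbreakable G s k) {Z : Finset (Fin n)} (hZ : #Z ≤ k)
    (h : ∀ v ∉ Z, #{u | u ∈ ((isolate G Z).connectedComponentMk v).supp} ≤ s) :
    #Zᶜ ≤ 3 * s := by
  obtain ⟨X, hX, hmax⟩ := Finset.exists_max_image
    {X : Finset (Fin n) | IsComponentUnion G Z X ∧ #X ≤ s} Finset.card
    ⟨∅, by simp [IsComponentUnion.empty]⟩
  rw [Finset.mem_filter_univ] at hX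
  by_cases hcover : Zᶜ ⊆ X
  · exact (Finset.card_le_card hcover).trans (by omega)
  obtain ⟨v, hvZ, hvX⟩ := Finset.not_subset.1 hcover
  rw [Finset.mem_compl] at hvZ
  set C : Finset (Fin n) := {u | u ∈ ((isolate G Z).connectedComponentMk v).supp} with hC
  have hXC : IsComponentUnion G Z (X ∪ C) := hX.1.union (.supp hvZ)
  have grows : #X < #(X ∪ C) := Finset.card_lt_card
    ⟨Finset.subset_union_left, fun h => hvX (h (Finset.mem_union_right _ (by simp [hC])))⟩
  have large : s < #(X ∪ C) := by
    by_contra! hle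
    exact (hmax _ (by simp [hXC, hle])).not_gt grows
  have rest : #((X ∪ C)ᶜ \ Z) < s :=
    (hXC.card_lt_or_card_compl_lt hG hZ).resolve_left large.le.not_gt
  have cover : Zᶜ ⊆ (X ∪ C) ∪ ((X ∪ C)ᶜ \ Z) := fun u hu => by
    simp only [Finset.mem_union, Finset.mem_sdiff, Finset.mem_compl] at hu ⊢
    tauto
  calc #Zᶜ ≤ #(X ∪ C) + #((X ∪ C)ᶜ \ Z) :=
        (Finset.card_le_card cover).trans (Finset.card_union_le _ _)
    _ ≤ (#X + #C) + #((X ∪ C)ᶜ \ Z) := by grw [Finset.card_union_le]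
    _ ≤ 3 * s := by have small : #C ≤ s := h v hvZ; omega

open Classical in
theorem exists_card_compl_supp_le {n s k : ℕ} {G : SimpleGraph (Fin n)}
    (hG : IsUnbreakable G s k) {Z : Finset (Fin n)} (hZ : #Z ≤ k) (hn : k < n) :
    ∃ v ∉ Z, #{u | u ∉ Z ∧ u ∉ ((isolate G Z).connectedComponentMk v).supp} ≤ 3 * s := by
  by_cases hbig : ∃ v ∉ Z, s < #{u | u ∈ ((isolate G Z).connectedComponentMk v).supp}
  · obtain ⟨v, hv, hs⟩ := hbig
    have rest :=
      ((IsComponentUnion.supp hv).card_lt_or_card_compl_lt hG hZ).resolve_left hs.le.not_gt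
    refine ⟨v, hv, (Finset.card_le_card fun u hu => ?_).trans (rest.le.trans (by omega))⟩
    simpa [and_comm] using hu
  · push Not at hbig
    obtain ⟨v, hv⟩ : ∃ v, v ∉ Z := by
      by_contra! h
      have : #Z = n := by rw [Finset.eq_univ_of_forall h, Finset.card_fin]
      omega
    refine ⟨v, hv, (Finset.card_le_card fun u hu => ?_).trans
      (card_compl_le_of_forall_card_supp_le hG hZ hbig)⟩
    rw [Finset.mem_filter_univ] at hu
    simpa using hu.1

open Classical in
/-- The labelling that deletes `Z` and assigns to each component of `G - Z` the class `cls`. -/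
noncomputable def componentLabelling (G : SimpleGraph V) (Z : Finset V)
    (cls : (isolate G Z).ConnectedComponent → ι) (v : V) : Option ι :=
  if v ∈ Z then none else some (cls ((isolate G Z).connectedComponentMk v))

section ComponentLabelling

variable {G : SimpleGraph V} {Z : Finset V} {cls : (isolate G Z).ConnectedComponent → ι}

theorem componentLabelling_eq_none {v : V} : componentLabelling G Z cls v = none ↔ v ∈ Z := by
  simp [componentLabelling]

theorem componentLabelling_of_notMem {v : V} (hv : v ∉ Z) :
    componentLabelling G Z cls v = some (cls ((isolate G Z).connectedComponentMk v)) :=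
  if_neg hv

theorem isSolution_componentLabelling [Fintype V] {Γ : ι → GraphClass}
    (hΓ : ∀ i, (Γ i).IsHereditary) {k : ℕ} (hZ : #Z ≤ k)
    (hcls : ∀ v ∉ Z, (Γ (cls ((isolate G Z).connectedComponentMk v))).Mem
      (G.induce ((isolate G Z).connectedComponentMk v).supp)) :
    IsSolution Γ G k (componentLabelling G Z cls) where
  card_le := (Finset.card_le_card fun v hv => by
    simpa [componentLabelling_eq_none] using hv).trans hZ
  adj u v hadj := by
    by_cases hu : u ∈ Z
    · exact .inl (componentLabelling_eq_none.2 hu)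
    by_cases hv : v ∈ Z
    · exact .inr (.inl (componentLabelling_eq_none.2 hv))
    have same_component := SimpleGraph.ConnectedComponent.sound
      (show (isolate G Z).Adj u v from ⟨hadj, hu, hv⟩).reachable
    rw [componentLabelling_of_notMem hu, componentLabelling_of_notMem hv, same_component]
    exact .inr (.inr rfl)
  mem j S hS hc := by
    have hSZ : S ⊆ (Z : Set V)ᶜ := fun u hu hZ => by
      have := hS hu
      simp [componentLabelling_eq_none.2 hZ] at this
    obtain ⟨v, hv⟩ := hc.nonempty
    have hj : cls ((isolate G Z).connectedComponentMk v) = j := by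
      simpa [componentLabelling_of_notMem (hSZ hv)] using hS hv
    rw [← induce_isolate hSZ] at hc
    exact ⟨(), GraphClass.mem_induce_of_subset (hΓ j) (subset_supp_of_connected hc hv)
      (hj ▸ hcls v (hSZ hv))⟩

end ComponentLabelling

/-- A solution in which at most `r` vertices have a class other than `i`, and they are in components
that are not in the class `i`. -/
structure IsSmallSolution (Γ : ι → GraphClass) [Fintype V] [DecidableEq ι] (G : SimpleGraph V)
    (k r : ℕ) (i : ι) (lab : V → Option ι) : Prop extends IsSolution Γ G k lab where
  card_other_le : #{v | lab v ≠ none ∧ lab v ≠ some i} ≤ r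
  exists_not_mem : ∀ v, lab v ≠ none → lab v ≠ some i → ∃ S : Set V, v ∈ S ∧
    (G.induce S).Connected ∧ (∀ u ∈ S, lab u = lab v) ∧ ¬ (Γ i).Mem (G.induce S)

theorem exists_class_preferring (Γ : ι → GraphClass) [Finite V]
    {H G : SimpleGraph V} (i : ι) :
    ∃ cls : H.ConnectedComponent → ι, ∀ C,
      ((∃ j, (Γ j).Mem (G.induce C.supp)) → (Γ (cls C)).Mem (G.induce C.supp)) ∧
      ((Γ i).Mem (G.induce C.supp) → cls C = i) := by
  refine Classical.axiom_of_choice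
    (r := fun (C : H.ConnectedComponent) j =>
      ((∃ j, (Γ j).Mem (G.induce C.supp)) → (Γ j).Mem (G.induce C.supp)) ∧
      ((Γ i).Mem (G.induce C.supp) → j = i)) fun C => ?_
  by_cases hi : (Γ i).Mem (G.induce C.supp)
  · exact ⟨i, fun _ => hi, fun _ => rfl⟩
  · by_cases hj : ∃ j, (Γ j).Mem (G.induce C.supp)
    · exact ⟨hj.choose, fun _ => hj.choose_spec, fun h => absurd h hi⟩
    · exact ⟨i, fun h => absurd h hj, fun _ => rfl⟩

theorem exists_isSmallSolution [DecidableEq ι] {Γ : ι → GraphClass} (hΓ : ∀ i, (Γ i).IsHereditary)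
    {n s k : ℕ} {G : SimpleGraph (Fin n)} (hG : IsUnbreakable G s k) (hn : k < n)
    (h : VertexDeletion Γ n G k) : ∃ i lab, IsSmallSolution Γ G k (3 * s) i lab := by
  classical
  obtain ⟨Z, hZ, hgood⟩ := (vertexDeletion_iff hΓ G k).1 h
  have hex (v : Fin n) (hv : v ∉ Z) :
      ∃ j, (Γ j).Mem (G.induce ((isolate G Z).connectedComponentMk v).supp) :=
    hgood _ (fun _ => notMem_of_mem_supp_isolate hv) (connected_induce_supp_isolate _)
  obtain ⟨v₀, hv₀, hcard⟩ := exists_card_compl_supp_le hG hZ hn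
  obtain ⟨i, hi⟩ := hex v₀ hv₀
  obtain ⟨cls, hcls⟩ := exists_class_preferring Γ (H := isolate G Z) (G := G) i
  refine ⟨i, componentLabelling G Z cls,
    isSolution_componentLabelling hΓ hZ fun v hv => (hcls _).1 (hex v hv),
    (Finset.card_le_card fun v hv => ?_).trans hcard, fun v hvn hvi => ?_⟩
  · simp only [Finset.mem_filter_univ, ne_eq, componentLabelling_eq_none] at hv ⊢
    refine ⟨hv.1, fun hv₀ => hv.2 ?_⟩
    rw [componentLabelling_of_notMem hv.1,
      (SimpleGraph.ConnectedComponent.mem_supp_iff _ _).1 hv₀, (hcls _).2 hi]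
  · have hvZ : v ∉ Z := componentLabelling_eq_none.not.1 hvn
    refine ⟨((isolate G Z).connectedComponentMk v).supp, rfl, connected_induce_supp_isolate _,
      fun u hu => ?_, fun hmem => hvi ?_⟩
    · rw [componentLabelling_of_notMem hvZ,
        componentLabelling_of_notMem (notMem_of_mem_supp_isolate hvZ hu),
        (SimpleGraph.ConnectedComponent.mem_supp_iff _ _).1 hu]
    · rw [componentLabelling_of_notMem hvZ, (hcls _).2 hmem]

end Labelling

/-! ## The algorithm -/

section Algorithm

open scoped Finset

/-- Graphs on `{0, …, n - 1}` for some `n`, the inputs of programs. -/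
structure FinGraph where
  order : ℕ
  graph : SimpleGraph (Fin order)

namespace FinGraph

open Classical in
/-- The adjacency matrix, which is what programs see of a graph. -/
noncomputable def rows (g : FinGraph) : List (List Bool) :=
  List.ofFn fun i => List.ofFn fun j => decide (g.graph.Adj i j)

/-- The adjacency relation, read off the adjacency matrix; it fails for numbers that are not
vertices. -/
noncomputable def adj (g : FinGraph) (u v : ℕ) : Bool := (g.rows.getD u []).getD v false

theorem adj_coe (g : FinGraph) (u v : Fin g.order) : g.adj u v = true ↔ g.graph.Adj u v := by
  simp [adj, rows, List.getD_eq_getElem?_getD]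

/-- The vertices with the property `p`. -/
def vertices (g : FinGraph) (p : ℕ → Bool) : List ℕ := (List.range g.order).filter p

theorem mem_vertices {g : FinGraph} {p : ℕ → Bool} {v : ℕ} :
    v ∈ g.vertices p ↔ v < g.order ∧ p v = true := by
  rw [vertices, List.mem_filter, List.mem_range]

theorem nodup_vertices (g : FinGraph) (p : ℕ → Bool) : (g.vertices p).Nodup :=
  List.nodup_range.filter _

theorem length_vertices (g : FinGraph) (p : ℕ → Bool) :
    (g.vertices p).length = #{v : Fin g.order | p v = true} := by
  rw [← List.toFinset_card_of_nodup (g.nodup_vertices p), ← Finset.card_map Fin.valEmbedding]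
  congr 1
  ext v
  simp [mem_vertices, Fin.exists_iff, and_comm]

/-- The enumeration of the vertices with the property `p`. -/
def enumerate (g : FinGraph) (p : ℕ → Bool) : Fin (g.vertices p).length ↪ Fin g.order where
  toFun i := ⟨(g.vertices p)[i], (mem_vertices.1 (List.getElem_mem i.2)).1⟩
  inj' _ _ h := Fin.ext ((g.nodup_vertices p).getElem_inj_iff.1 (congrArg Fin.val h))

theorem range_enumerate (g : FinGraph) (p : ℕ → Bool) :
    Set.range (g.enumerate p) = {v : Fin g.order | p v = true} := by
  ext v
  constructor
  · rintro ⟨i, rfl⟩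
    exact (mem_vertices.1 (List.getElem_mem i.2)).2
  · intro hv
    obtain ⟨i, hi, h⟩ := List.getElem_of_mem (mem_vertices.2 ⟨v.2, hv⟩)
    exact ⟨⟨i, hi⟩, Fin.ext h⟩

/-- The graph induced by the vertices with the property `p`. -/
def induce (g : FinGraph) (p : ℕ → Bool) : FinGraph :=
  ⟨(g.vertices p).length, g.graph.comap (g.enumerate p)⟩

theorem rows_induce (g : FinGraph) (p : ℕ → Bool) :
    (g.induce p).rows = (g.vertices p).map fun u => (g.vertices p).map fun v => g.adj u v := by
  classical
  refine List.ext_getElem (by simp [rows, induce]) fun i hi _ => ?_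
  refine List.ext_getElem (by simp [rows, induce]) fun j hj _ => ?_
  simp only [rows, List.getElem_ofFn, List.getElem_map]
  rw [Bool.eq_iff_iff, decide_eq_true_eq]
  exact (g.adj_coe (g.enumerate p ⟨i, _⟩)
    (g.enumerate p ⟨j, _⟩)).symm

end FinGraph

open Classical in
/-- The answer to the problem of vertex deletion to a single class, as given by one of the programs
that the algorithm calls. -/
noncomputable def solve (Γ : GraphClass) (g : FinGraph) (k : ℕ) : Bool :=
  decide (VertexDeletion (fun _ : Unit => Γ) g.order g.graph k)

theorem solve_induce_iff {Γ : GraphClass} (hΓ : Γ.IsHereditary) (g : FinGraph) (p : ℕ → Bool)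
    (k : ℕ) :
    solve Γ (g.induce p) k = true ↔ ∃ Z : Finset (Fin g.order), #Z ≤ k ∧
      ConnectedIn (fun _ : Unit => Γ) g.graph ({v | p v = true} \ Z) := by
  classical
  rw [← g.range_enumerate p, ← vertexDeletion_comap_iff (fun _ => hΓ) g.graph (g.enumerate p) k,
    solve, decide_eq_true_eq, FinGraph.induce]

/-! ### A modulator by self-reduction -/

/-- Decides whether `M` is contained in a modulator of size at most `T`: a set of vertices outside
of which all components are in the class. -/
noncomputable def isExtendable (Γ : GraphClass) (g : FinGraph) (T : ℕ) (M : List ℕ) : Bool :=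
  decide (M.length ≤ T) && solve Γ (g.induce fun u => !decide (u ∈ M)) (T - M.length)

/-- A modulator of size at most `T`, if there is one. -/
noncomputable def modulator (Γ : GraphClass) (g : FinGraph) (T : ℕ) : List ℕ :=
  (List.range g.order).foldl (fun M v => if isExtendable Γ g T (v :: M) then v :: M else M) []

theorem isExtendable_iff {Γ : GraphClass} (hΓ : Γ.IsHereditary) {g : FinGraph} {T : ℕ}
    {M : List ℕ} :
    isExtendable Γ g T M = true ↔ ∃ Z : Finset (Fin g.order), #Z + M.length ≤ T ∧
      ConnectedIn (fun _ : Unit => Γ) g.graph {v | ↑v ∉ M ∧ v ∉ Z} := by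
  simp only [isExtendable, Bool.and_eq_true, decide_eq_true_eq, solve_induce_iff hΓ,
    Bool.not_eq_true', decide_eq_false_iff_not, ← exists_and_left, ← and_assoc]
  refine exists_congr fun Z => and_congr_left fun _ => ?_
  omega

theorem foldl_greedy {α : Type*} (p : List α → Bool) (l : List α) (hnil : p [] = true)
    (hp : ∀ u v M, p (u :: v :: M) = true → p (u :: M) = true) {M : List α}
    (hM : l.foldl (fun M v => if p (v :: M) then v :: M else M) [] = M) :
    p M = true ∧ ∀ u ∈ l, p (u :: M) = true → u ∈ M := by
  induction l using List.reverseRecOn generalizing M with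
  | nil => exact ⟨by rwa [← hM], by simp⟩
  | append_singleton l v ih =>
    obtain ⟨hpM, hmax⟩ := ih rfl
    rw [List.foldl_append, List.foldl_cons, List.foldl_nil] at hM
    simp only [List.mem_append, List.mem_singleton]
    split_ifs at hM with hv <;> subst hM
    · refine ⟨hv, ?_⟩
      rintro u (hu | rfl) hpu
      · exact List.mem_cons_of_mem _ (hmax u hu (hp _ _ _ hpu))
      · exact List.mem_cons_self
    · refine ⟨hpM, ?_⟩
      rintro u (hu | rfl) hpu
      · exact hmax u hu hpu
      · exact absurd hpu hv

theorem isExtendable_of_cons_cons {Γ : GraphClass} (hΓ : Γ.IsHereditary) {g : FinGraph} {T : ℕ}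
    (u v : ℕ) (M : List ℕ) (h : isExtendable Γ g T (u :: v :: M) = true) :
    isExtendable Γ g T (u :: M) = true := by
  obtain ⟨Z, hZ, h⟩ := (isExtendable_iff hΓ).1 h
  simp only [List.length_cons] at hZ
  refine (isExtendable_iff hΓ).2 ⟨Z ∪ ({w | ↑w = v} : Finset (Fin g.order)), ?_, h.mono fun w => ?_⟩
  · have card_eq_le : #{w : Fin g.order | ↑w = v} ≤ 1 :=
      Finset.card_le_one.2 fun a ha b hb => Fin.ext (by simp_all)
    have := Finset.card_union_le Z {w : Fin g.order | ↑w = v}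
    simp only [List.length_cons]
    omega
  · simp only [Set.mem_ofPred_eq, List.mem_cons, Finset.mem_union, Finset.mem_filter_univ]
    tauto

theorem modulator_spec {Γ : GraphClass} (hΓ : Γ.IsHereditary) {g : FinGraph} {T : ℕ}
    {Y : Finset (Fin g.order)} (hY : #Y ≤ T)
    (h : ConnectedIn (fun _ : Unit => Γ) g.graph (Y : Set (Fin g.order))ᶜ) :
    (modulator Γ g T).length ≤ T ∧
      ConnectedIn (fun _ : Unit => Γ) g.graph {v | ↑v ∉ modulator Γ g T} := by
  have hnil : isExtendable Γ g T [] = true :=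
    (isExtendable_iff hΓ).2 ⟨Y, hY, h.mono fun v hv => hv.2⟩
  obtain ⟨hext, hmax⟩ :=
    foldl_greedy _ _ hnil (isExtendable_of_cons_cons hΓ) (M := modulator Γ g T) rfl
  obtain ⟨Z, hZ, hc⟩ := (isExtendable_iff hΓ).1 hext
  refine ⟨by omega, hc.mono fun v hv => ⟨hv, fun hvZ => hv ?_⟩⟩
  -- A vertex of `Z` could have been moved to the modulator.
  refine hmax v (List.mem_range.2 v.2)
    ((isExtendable_iff hΓ).2 ⟨Z.erase v, ?_, hc.mono fun u hu => ?_⟩)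
  · have := Finset.card_erase_add_one hvZ
    simp only [List.length_cons]
    omega
  · simp only [Set.mem_ofPred_eq, List.mem_cons, Finset.mem_erase, not_or] at hu ⊢
    tauto

end Algorithm

/-! ### Branching over partial labellings -/

section Branching

open scoped Finset

variable {d : ℕ}

/-- A list of vertices with their labels: deleted, or one of the classes. -/
abbrev PartialLabelling (d : ℕ) : Type := List (ℕ × Option (Fin d))

/-- The label of `v` in `l`; the label `i` if it has none. -/
def labelOf (i : Fin d) (l : PartialLabelling d) (v : ℕ) : Option (Fin d) :=
  ((l.filter fun e => decide (e.1 = v)).map Prod.snd).headD (some i)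

/-- The vertices on which the search branches: those without a label that are in the modulator `M`
or adjacent to a vertex labelled by a class other than `i`. -/
noncomputable def isPending (i : Fin d) (g : FinGraph) (M : List ℕ) (l : PartialLabelling d)
    (v : ℕ) : Bool :=
  !decide (v ∈ l.map Prod.fst) && (decide (v ∈ M) || (List.range g.order).any fun u =>
    g.adj u v && (!decide (labelOf i l u = none) && !decide (labelOf i l u = some i)))

/-- The list of all labels. -/
def labels (d : ℕ) : List (Option (Fin d)) := none :: (List.finRange d).map some

/-- The extensions of `l` to its first pending vertex; `l` itself if there is none. -/
noncomputable def expand (i : Fin d) (g : FinGraph) (M : List ℕ) (l : PartialLabelling d) :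
    List (PartialLabelling d) :=
  match g.vertices (isPending i g M l) with
  | [] => [l]
  | v :: _ => (labels d).map fun a => (v, a) :: l

/-- The partial labellings reached from the empty one after `r` rounds of branching. -/
noncomputable def branches (i : Fin d) (g : FinGraph) (M : List ℕ) : ℕ → List (PartialLabelling d)
  | 0 => [[]]
  | r + 1 => (branches i g M r).flatMap (expand i g M)

/-- Decides whether `l`, with all other vertices labelled by `i`, becomes a solution after the
deletion of further vertices labelled by `i`. -/
noncomputable def check (Γ : Fin d → GraphClass) (i : Fin d) (g : FinGraph) (k : ℕ)
    (l : PartialLabelling d) : Bool :=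
  decide ((g.vertices fun v => decide (labelOf i l v = none)).length ≤ k) &&
  ((List.range g.order).all (fun u => (List.range g.order).all fun v => !g.adj u v ||
    (decide (labelOf i l u = none) || (decide (labelOf i l v = none) ||
      decide (labelOf i l u = labelOf i l v)))) &&
  decide (∀ j : Fin d, solve (Γ j) (g.induce fun v => decide (labelOf i l v = some j))
    (if j = i then k - (g.vertices fun v => decide (labelOf i l v = none)).length else 0) = true))

/-- Decides whether there is a solution whose labels other than `i` are found by branching. -/
noncomputable def search (Γ : Fin d → GraphClass) (i : Fin d) (g : FinGraph) (k T : ℕ) : Bool :=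
  (branches i g (modulator (Γ i) g T) (T + T)).any (check Γ i g k)

/-- Decides the problem of vertex deletion on unbreakable graphs, if `T` is large enough. -/
noncomputable def algorithm (Γ : Fin d → GraphClass) (g : FinGraph) (k T : ℕ) : Bool :=
  decide (g.order ≤ k) || decide (∃ i, search Γ i g k T = true)

theorem check_iff {Γ : Fin d → GraphClass} (hΓ : ∀ i, (Γ i).IsHereditary) {i : Fin d}
    {g : FinGraph} {k : ℕ} {l : PartialLabelling d} :
    check Γ i g k l = true ↔ #{v : Fin g.order | labelOf i l v = none} ≤ k ∧
      (∀ u v : Fin g.order, g.graph.Adj u v →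
        labelOf i l u = none ∨ labelOf i l v = none ∨ labelOf i l u = labelOf i l v) ∧
      ∀ j, ∃ Z : Finset (Fin g.order),
        #Z ≤ (if j = i then k - #{v : Fin g.order | labelOf i l v = none} else 0) ∧
        ConnectedIn (fun _ : Unit => Γ j) g.graph ({v | labelOf i l v = some j} \ Z) := by
  simp only [check, Bool.and_eq_true, decide_eq_true_eq, solve_induce_iff (hΓ _),
    FinGraph.length_vertices, List.all_eq_true, List.mem_range, Bool.or_eq_true, Bool.not_eq_true']
  refine and_congr_right fun _ => and_congr_left fun _ => ⟨fun h u v huv => ?_,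
    fun h u hu v hv => ?_⟩
  · rw [← g.adj_coe] at huv
    exact (h u u.2 v v.2).resolve_left (by simp [huv])
  · rw [← Bool.not_eq_true, ← imp_iff_not_or]
    exact fun huv => h ⟨u, hu⟩ ⟨v, hv⟩ ((g.adj_coe ⟨u, hu⟩ ⟨v, hv⟩).1 huv)

theorem vertexDeletion_of_check {Γ : Fin d → GraphClass} (hΓ : ∀ i, (Γ i).IsHereditary)
    {g : FinGraph} {k : ℕ} {i : Fin d} {l : PartialLabelling d} (h : check Γ i g k l = true) :
    VertexDeletion Γ g.order g.graph k := by
  obtain ⟨hk, hadj, hmem⟩ := (check_iff hΓ).1 h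
  obtain ⟨Z, hZ, hi⟩ := hmem i
  rw [if_pos rfl] at hZ
  refine IsSolution.vertexDeletion hΓ (lab := fun v => if v ∈ Z then none else labelOf i l v)
    ⟨?_, fun u v huv => ?_, fun j => ?_⟩
  · have subset_union : ({v | (if v ∈ Z then none else labelOf i l v) = none} : Finset _) ⊆
        ({v | labelOf i l v = none} : Finset (Fin g.order)) ∪ Z := fun v hv => by
      simp only [Finset.mem_union, Finset.mem_filter_univ, ite_eq_left_iff] at hv ⊢
      tauto
    exact (Finset.card_le_card subset_union).trans ((Finset.card_union_le _ _).trans (by omega))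
  · have := hadj u v huv
    grind
  · rcases eq_or_ne j i with rfl | hj
    · exact hi.mono fun v hv => by grind
    · obtain ⟨Z', hZ', hj'⟩ := hmem j
      rw [if_neg hj, Nat.le_zero, Finset.card_eq_zero] at hZ'
      exact hj'.mono fun v hv => by grind

/-- The entries of `l` are vertices with their labels in `lab`. -/
def Agrees {n : ℕ} (l : PartialLabelling d) (lab : Fin n → Option (Fin d)) : Prop :=
  ∀ e ∈ l, ∃ h : e.1 < n, e.2 = lab ⟨e.1, h⟩

theorem labelOf_eq_of_agrees {n : ℕ} {i : Fin d} {lab : Fin n → Option (Fin d)}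
    {l : PartialLabelling d} (hl : Agrees l lab) (v : Fin n) :
    labelOf i l v = if ↑v ∈ l.map Prod.fst then lab v else some i := by
  induction l with
  | nil => simp [labelOf]
  | cons e l ih =>
    obtain ⟨⟨hen, he⟩, hl⟩ := List.forall_mem_cons.1 hl
    rcases eq_or_ne e.1 v with hv | hv
    · simp [labelOf, hv, he]
    · have : labelOf i (e :: l) v = labelOf i l v := by simp [labelOf, hv]
      simp [this, ih hl, hv.symm]

/-- The vertices that may still become pending when the labels are taken from `lab`. -/
def candidates {n : ℕ} (i : Fin d) (M : List ℕ) (lab : Fin n → Option (Fin d))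
    (l : PartialLabelling d) : Finset (Fin n) :=
  {v | (↑v ∈ M ∨ lab v ≠ some i) ∧ ↑v ∉ l.map Prod.fst}

theorem card_candidates_nil_le {n : ℕ} (i : Fin d) (M : List ℕ) (lab : Fin n → Option (Fin d)) :
    #(candidates i M lab []) ≤ M.length + #{v | lab v ≠ some i} := by
  have card_mem_le : #{v : Fin n | ↑v ∈ M} ≤ M.length := by
    refine le_trans ?_ (List.toFinset_card_le M)
    exact Finset.card_le_card_of_injOn Fin.val (fun v hv => by simpa using hv)
      Fin.val_injective.injOn
  calc #(candidates i M lab [])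
      = #(({v | ↑v ∈ M} : Finset (Fin n)) ∪ ({v | lab v ≠ some i} : Finset (Fin n))) := by
        congr 1
        ext v
        simp [candidates]
    _ ≤ _ := (Finset.card_union_le _ _).trans (Nat.add_le_add_right card_mem_le _)

section Rounds

variable {i : Fin d} {g : FinGraph} {M : List ℕ} {l : PartialLabelling d}
  {lab : Fin g.order → Option (Fin d)}

theorem mem_candidates_of_isPending
    (hadj : ∀ u v, g.graph.Adj u v → lab u = none ∨ lab v = none ∨ lab u = lab v)
    (hl : Agrees l lab) {v : Fin g.order} (hv : isPending i g M l v = true) :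
    v ∈ candidates i M lab l := by
  simp only [isPending, Bool.and_eq_true, Bool.not_eq_true', Bool.or_eq_true, List.any_eq_true,
    decide_eq_true_eq, decide_eq_false_iff_not, List.mem_range] at hv
  obtain ⟨hvl, hvM | ⟨u, hu, huv, hun, hui⟩⟩ := hv
  · exact (Finset.mem_filter_univ _).2 ⟨.inl hvM, hvl⟩
  · lift u to Fin g.order using hu
    have := hadj u v ((g.adj_coe u v).1 huv)
    rw [labelOf_eq_of_agrees hl] at hun hui
    exact (Finset.mem_filter_univ _).2 ⟨.inr (by grind), hvl⟩

theorem mem_expand_self (h : ∀ v : Fin g.order, isPending i g M l v = false) :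
    l ∈ expand i g M l := by
  have vertices_eq : g.vertices (isPending i g M l) = [] :=
    List.filter_eq_nil_iff.2 fun v hv => by simpa using h ⟨v, List.mem_range.1 hv⟩
  simp [expand, vertices_eq]

theorem exists_mem_expand
    (hadj : ∀ u v, g.graph.Adj u v → lab u = none ∨ lab v = none ∨ lab u = lab v)
    (hl : Agrees l lab) (h : ∃ v : Fin g.order, isPending i g M l v = true) :
    ∃ l' ∈ expand i g M l, Agrees l' lab ∧ candidates i M lab l' ⊂ candidates i M lab l := by
  obtain ⟨u, hu⟩ := h
  obtain ⟨v, vs, hvs⟩ := List.exists_cons_of_ne_nil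
    (List.ne_nil_of_mem (FinGraph.mem_vertices.2 ⟨u.2, hu⟩))
  obtain ⟨hvn, hv⟩ := FinGraph.mem_vertices.1 (hvs ▸ List.mem_cons_self : v ∈ g.vertices _)
  have mem_labels : lab ⟨v, hvn⟩ ∈ labels d := by cases lab ⟨v, hvn⟩ <;> simp [labels]
  refine ⟨(v, lab ⟨v, hvn⟩) :: l, by simpa [expand, hvs] using mem_labels,
    List.forall_mem_cons.2 ⟨⟨hvn, rfl⟩, hl⟩, Finset.ssubset_iff_subset_ne.2 ⟨fun w hw => ?_, ?_⟩⟩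
  · simp only [candidates, Finset.mem_filter_univ, List.map_cons, List.mem_cons, not_or] at hw ⊢
    tauto
  · intro heq
    have := heq ▸ mem_candidates_of_isPending hadj hl (v := ⟨v, hvn⟩) hv
    simp [candidates] at this

theorem exists_mem_branches
    (hadj : ∀ u v, g.graph.Adj u v → lab u = none ∨ lab v = none ∨ lab u = lab v) {r : ℕ}
    (hr : M.length + #{v | lab v ≠ some i} ≤ r) :
    ∃ l ∈ branches i g M r, Agrees l lab ∧ ∀ v : Fin g.order, isPending i g M l v = false := by
  have invariant (r : ℕ) : ∃ l ∈ branches i g M r, Agrees l lab ∧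
      ((∀ v : Fin g.order, isPending i g M l v = false) ∨
        #(candidates i M lab l) + r ≤ #(candidates i M lab [])) := by
    induction r with
    | zero => exact ⟨[], by simp [branches], by simp [Agrees], .inr le_rfl⟩
    | succ r ih =>
      obtain ⟨l, hlr, hl, hor⟩ := ih
      by_cases hex : ∃ v : Fin g.order, isPending i g M l v = true
      · obtain ⟨l', hl'l, hl', hlt⟩ := exists_mem_expand hadj hl hex
        have := Finset.card_lt_card hlt
        refine ⟨l', List.mem_flatMap.2 ⟨l, hlr, hl'l⟩, hl', .inr ?_⟩
        have := hor.resolve_left (by simpa using hex)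
        omega
      · have hpend : ∀ v : Fin g.order, isPending i g M l v = false := by simpa using hex
        exact ⟨l, List.mem_flatMap.2 ⟨l, hlr, mem_expand_self hpend⟩, hl, .inl hpend⟩
  obtain ⟨l, hlr, hl, hpend | hcard⟩ := invariant r
  · exact ⟨l, hlr, hl, hpend⟩
  · have candidates_eq : candidates i M lab l = ∅ := by
      have := card_candidates_nil_le i M lab
      exact Finset.card_eq_zero.1 (by omega)
    refine ⟨l, hlr, hl, fun v => Bool.eq_false_iff.2 fun hv => ?_⟩
    simpa [candidates_eq] using mem_candidates_of_isPending hadj hl hv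

theorem mem_labelled_of_mem (hpend : ∀ v : Fin g.order, isPending i g M l v = false)
    {v : Fin g.order} (hv : ↑v ∈ M) : ↑v ∈ l.map Prod.fst := by
  by_contra hvl
  simpa [isPending, hv, hvl] using hpend v

theorem mem_labelled_of_adj (hpend : ∀ v : Fin g.order, isPending i g M l v = false)
    (hl : Agrees l lab) {u v : Fin g.order} (huv : g.graph.Adj u v) (hu : ↑u ∈ l.map Prod.fst)
    (hun : lab u ≠ none) (hui : lab u ≠ some i) : ↑v ∈ l.map Prod.fst := by
  by_contra hvl
  refine Bool.eq_false_iff.1 (hpend v) ?_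
  simp only [isPending, Bool.and_eq_true, Bool.not_eq_true', Bool.or_eq_true, List.any_eq_true,
    decide_eq_true_eq, decide_eq_false_iff_not, List.mem_range]
  refine ⟨hvl, .inr ⟨u, u.2, (g.adj_coe u v).2 huv, ?_⟩⟩
  rw [labelOf_eq_of_agrees hl, if_pos hu]
  exact ⟨hun, hui⟩

theorem IsSmallSolution.mem_labelled {Γ : Fin d → GraphClass} {k r : ℕ}
    (h : IsSmallSolution Γ g.graph k r i lab)
    (hM : ConnectedIn (fun _ : Unit => Γ i) g.graph {v | ↑v ∉ M})
    (hpend : ∀ v : Fin g.order, isPending i g M l v = false) (hl : Agrees l lab)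
    {v : Fin g.order} (hvn : lab v ≠ none) (hvi : lab v ≠ some i) : ↑v ∈ l.map Prod.fst := by
  obtain ⟨S, hvS, hc, hlabS, hnm⟩ := h.exists_not_mem v hvn hvi
  -- The component of `v` is not in the class `i`, so it is hit by the modulator, and from there
  -- the labels have spread along its edges.
  obtain ⟨m, hmS, hmM⟩ : ∃ m ∈ S, (m : ℕ) ∈ M := by
    by_contra! hSM
    exact hnm (hM S hSM hc).choose_spec
  exact connected_propagate hc (P := fun u => ↑u ∈ l.map Prod.fst)
    (fun u hu _ _ huw hul => mem_labelled_of_adj hpend hl huw hul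
      (hlabS u hu ▸ hvn) (hlabS u hu ▸ hvi)) hmS hvS (mem_labelled_of_mem hpend hmM)

theorem IsSmallSolution.check_eq_true {Γ : Fin d → GraphClass} (hΓ : ∀ i, (Γ i).IsHereditary)
    {k r : ℕ} (h : IsSmallSolution Γ g.graph k r i lab)
    (hM : ConnectedIn (fun _ : Unit => Γ i) g.graph {v | ↑v ∉ M})
    (hpend : ∀ v : Fin g.order, isPending i g M l v = false) (hl : Agrees l lab) :
    check Γ i g k l = true := by
  have label_eq (v : Fin g.order) := labelOf_eq_of_agrees (i := i) hl v
  have none_subset : ({v | labelOf i l v = none} : Finset (Fin g.order)) ⊆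
      ({v | lab v = none} : Finset (Fin g.order)) := fun v hv => by
    simp only [Finset.mem_filter_univ, label_eq] at hv ⊢
    grind
  have label_other {v : Fin g.order} (hvn : lab v ≠ none) (hvi : lab v ≠ some i) :
      labelOf i l v = lab v := by
    rw [label_eq, if_pos (h.mem_labelled hM hpend hl hvn hvi)]
  refine (check_iff hΓ).2 ⟨(Finset.card_le_card none_subset).trans h.card_le,
    fun u v huv => ?_, fun j => ?_⟩
  · have := h.adj u v huv
    have := label_eq u
    have := label_eq v
    have := mem_labelled_of_adj hpend hl huv
    have := mem_labelled_of_adj hpend hl huv.symm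
    grind
  · rcases eq_or_ne j i with rfl | hj
    · refine ⟨({v | lab v = none} : Finset (Fin g.order)) \
        ({v | labelOf j l v = none} : Finset (Fin g.order)), ?_, (h.mem j).mono fun v hv => ?_⟩
      · rw [if_pos rfl, Finset.card_sdiff_of_subset none_subset]
        exact Nat.sub_le_sub_right h.card_le _
      · by_contra hvj
        grind
    · refine ⟨∅, by simp, (h.mem j).mono fun v hv => ?_⟩
      have := label_eq v
      grind

end Rounds

theorem IsSmallSolution.search_eq_true {Γ : Fin d → GraphClass} (hΓ : ∀ i, (Γ i).IsHereditary)
    {g : FinGraph} {k r T : ℕ} {i : Fin d} {lab : Fin g.order → Option (Fin d)}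
    (h : IsSmallSolution Γ g.graph k r i lab) (hT : k + r ≤ T) : search Γ i g k T = true := by
  have card_ne_le : #{v | lab v ≠ some i} ≤ T := by
    have subset_union : ({v | lab v ≠ some i} : Finset (Fin g.order)) ⊆
        ({v | lab v = none} : Finset _) ∪
          ({v | lab v ≠ none ∧ lab v ≠ some i} : Finset (Fin g.order)) := fun v hv => by
      simp only [Finset.mem_filter_univ, Finset.mem_union] at hv ⊢
      tauto
    exact (Finset.card_le_card subset_union).trans ((Finset.card_union_le _ _).trans
      ((Nat.add_le_add h.card_le h.card_other_le).trans hT))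
  obtain ⟨hMlen, hM⟩ := modulator_spec (hΓ i) card_ne_le
    ((h.mem i).mono fun v hv => by simpa using hv)
  obtain ⟨l, hlm, hl, hpend⟩ := exists_mem_branches h.adj (Nat.add_le_add hMlen card_ne_le)
  exact List.any_eq_true.2 ⟨l, hlm, h.check_eq_true hΓ hM hpend hl⟩

theorem algorithm_iff {Γ : Fin d → GraphClass} (hΓ : ∀ i, (Γ i).IsHereditary) {g : FinGraph}
    {s k T : ℕ} (hG : IsUnbreakable g.graph s k) (hT : k + 3 * s ≤ T) :
    algorithm Γ g k T = true ↔ VertexDeletion Γ g.order g.graph k := by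
  simp only [algorithm, Bool.or_eq_true, decide_eq_true_eq]
  constructor
  · rintro (h | ⟨i, h⟩)
    · exact (vertexDeletion_iff hΓ g.graph k).2 ⟨Finset.univ, by simpa using h, fun S hS hc => by
        obtain ⟨v, hv⟩ := hc.nonempty
        simpa using hS hv⟩
    · obtain ⟨l, -, hl⟩ := List.any_eq_true.1 h
      exact vertexDeletion_of_check hΓ hl
  · intro h
    refine or_iff_not_imp_left.2 fun hn => ?_
    obtain ⟨i, lab, hlab⟩ := exists_isSmallSolution hΓ hG (not_le.1 hn) h
    exact ⟨i, hlab.search_eq_true hΓ hT⟩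

end Branching

/-! ## Running time of the algorithm -/

section RunningTime

noncomputable instance : Enc FinGraph := ⟨fun g => enc g.rows, fun g => weight g.rows⟩

/-- The number that encodes a label. -/
def labelCode {d : ℕ} : Option (Fin d) → ℕ
  | none => 0
  | some j => j + 1

theorem labelCode_injective {d : ℕ} : Function.Injective (labelCode (d := d)) := by
  rintro (_ | a) (_ | b) h <;> simp_all [labelCode, Fin.ext_iff]

instance {d : ℕ} : Enc (Option (Fin d)) :=
  ⟨fun a => enc (labelCode a), fun a => weight (labelCode a)⟩

theorem weight_label_le {d : ℕ} (a : Option (Fin d)) : weight a ≤ 2 * d + 1 := by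
  change 2 * labelCode a + 1 ≤ _
  rcases a with _ | a <;> simp [labelCode]

theorem encodeGraph_eq_enc {n : ℕ} (G : SimpleGraph (Fin n)) :
    encodeGraph G = enc (FinGraph.mk n G) := by
  change _ = Data.ofList
    (List.map (fun l => Data.ofList (List.map Data.ofBool l)) (FinGraph.rows _))
  simp only [encodeGraph, FinGraph.rows, List.map_ofFn, Function.comp_def]

theorem encodeInstance_eq_enc {n : ℕ} (G : SimpleGraph (Fin n)) (k : ℕ) :
    encodeInstance G k = enc (FinGraph.mk n G, k) := by
  rw [encodeInstance, encodeGraph_eq_enc]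
  rfl

theorem size_enc_list {α : Type} [Enc α] (h : ∀ a : α, (enc a).size = weight a) (l : List α) :
    (enc l).size = weight l := by
  induction l with
  | nil => rfl
  | cons a l ih => simp [Data.size, h, ih]

theorem size_encodeGraph {n : ℕ} (G : SimpleGraph (Fin n)) :
    (encodeGraph G).size = weight (FinGraph.mk n G) := by
  rw [encodeGraph_eq_enc]
  exact size_enc_list (fun l => size_enc_list (fun _ => rfl) l) _

/-- The problem of vertex deletion to the class is solved in time polynomial in the weight of the
input and the value of `F` at the parameter. -/
def Solvable (Γ : GraphClass) (F : ℕ → ℕ) : Prop :=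
  ∀ {α : Type} [Enc α] {g : α → FinGraph} {k : α → ℕ}, PolyTime g → PolyTime k →
    PolyBounded (fun a => F (k a)) → PolyTime fun a => solve Γ (g a) (k a)

theorem FPT.exists_solvable {Γ : GraphClass} (h : FPT (VertexDeletion fun _ : Unit => Γ)) :
    ∃ f : ℕ → ℕ, Computable f ∧ Solvable Γ f := by
  obtain ⟨p, f, c, hf, h⟩ := h
  refine ⟨f, hf, fun {α} _ {g k} hg hk hF => ?_⟩
  have hgw := hg.polyBounded
  obtain ⟨q, T, hT, hq, -⟩ := hg.pair hk
  refine ⟨q.seq p.clean, fun a => T a + (f (k a) * weight (g a) ^ c + 3 * p.bound + 15) + 1,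
    .add (.add hT (.add (.add (.mul hF (hgw.pow c)) (.const _)) (.const 15))) (.const 1),
    fun a => (hq a).seq (Run.clean ?_), (PolyBounded.const 3).mono fun a => weight_bool_le _⟩
  have decides := h (g a).order (g a).graph (k a) trivial
  rw [size_encodeGraph, encodeInstance_eq_enc] at decides
  simpa only [solve, decide_eq_true_eq] using decides

namespace PolyTime

variable {α : Type} [Enc α] {d : ℕ}

@[fun_prop]
theorem graph_rows {g : α → FinGraph} (hg : PolyTime g) : PolyTime fun a => (g a).rows := hg

@[fun_prop]
theorem graph_order {g : α → FinGraph} (hg : PolyTime g) : PolyTime fun a => (g a).order := by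
  have : PolyTime fun a => (g a).rows.length := by fun_prop
  simpa [FinGraph.rows] using this

@[fun_prop]
theorem graph_adj {g : α → FinGraph} {u v : α → ℕ} (hg : PolyTime g) (hu : PolyTime u)
    (hv : PolyTime v) : PolyTime fun a => (g a).adj (u a) (v a) := by
  simp only [FinGraph.adj]
  fun_prop

@[fun_prop]
theorem graph_vertices {g : α → FinGraph} {p : α → ℕ → Bool} (hg : PolyTime g)
    (hp : PolyTime fun x : α × ℕ => p x.1 x.2) : PolyTime fun a => (g a).vertices (p a) := by
  simp only [FinGraph.vertices]
  fun_prop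

@[fun_prop]
theorem graph_induce {g : α → FinGraph} {p : α → ℕ → Bool} (hg : PolyTime g)
    (hp : PolyTime fun x : α × ℕ => p x.1 x.2) : PolyTime fun a => (g a).induce (p a) := by
  change PolyTime fun a => ((g a).induce (p a)).rows
  simp only [FinGraph.rows_induce]
  fun_prop

@[fun_prop]
theorem nat_mem {v : α → ℕ} {l : α → List ℕ} (hv : PolyTime v) (hl : PolyTime l) :
    PolyTime fun a => decide (v a ∈ l a) := by
  have : PolyTime fun a => (l a).any fun w => decide (w = v a) := by fun_prop
  simpa [List.any_eq] using this

@[fun_prop]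
theorem label_eq {f g : α → Option (Fin d)} (hf : PolyTime f) (hg : PolyTime g) :
    PolyTime fun a => decide (f a = g a) := by
  have polyTime_labelCode : PolyTime (labelCode (d := d)) :=
    of_enc_eq (fun _ => rfl) fun _ => le_rfl
  have : PolyTime fun a => decide (labelCode (f a) = labelCode (g a)) := by fun_prop
  simpa only [labelCode_injective.eq_iff] using this

@[fun_prop]
theorem labelOf (i : Fin d) {l : α → PartialLabelling d} {v : α → ℕ} (hl : PolyTime l)
    (hv : PolyTime v) : PolyTime fun a => labelOf i (l a) (v a) := by
  simp only [Scattered.labelOf]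
  fun_prop

@[fun_prop]
theorem isPending (i : Fin d) {g : α → FinGraph} {M : α → List ℕ} {l : α → PartialLabelling d}
    {v : α → ℕ} (hg : PolyTime g) (hM : PolyTime M) (hl : PolyTime l) (hv : PolyTime v) :
    PolyTime fun a => isPending i (g a) (M a) (l a) (v a) := by
  simp only [Scattered.isPending]
  fun_prop

@[fun_prop]
theorem expand (i : Fin d) {g : α → FinGraph} {M : α → List ℕ} {l : α → PartialLabelling d}
    (hg : PolyTime g) (hM : PolyTime M) (hl : PolyTime l) :
    PolyTime fun a => expand i (g a) (M a) (l a) := by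
  convert list_cases (f := fun a => (g a).vertices (Scattered.isPending i (g a) (M a) (l a)))
    (g := fun a => [l a]) (h := fun a v _ => (labels d).map fun b => (v, b) :: l a)
    (by fun_prop) (by fun_prop) (by fun_prop) with a
  unfold Scattered.expand
  cases (g a).vertices (Scattered.isPending i (g a) (M a) (l a)) <;> rfl

end PolyTime

variable {α : Type} [Enc α] {d : ℕ}

theorem polyTime_modulator {Γ : GraphClass} {F : ℕ → ℕ} (hΓ : Solvable Γ F) (hF : Monotone F)
    {g : α → FinGraph} {T : α → ℕ} (hg : PolyTime g) (hT : PolyTime T)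
    (hFT : PolyBounded fun a => F (T a)) : PolyTime fun a => modulator Γ (g a) (T a) := by
  have polyTime_isExtendable : PolyTime fun x : α × List ℕ × ℕ =>
      isExtendable Γ (g x.1) (T x.1) (x.2.2 :: x.2.1) := by
    refine .bool_and (by fun_prop) (hΓ (by fun_prop) (by fun_prop) ?_)
    exact (hFT.comp (PolyTime.fst .id).polyBounded).mono fun x => hF (Nat.sub_le ..)
  have vertices_bounded : PolyBounded fun a => weight (List.range (g a).order) :=
    PolyTime.polyBounded (by fun_prop)
  refine PolyTime.foldl_of_weight_le_add (D := fun a => weight (List.range (g a).order) + 1)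
    (h := fun a M v => if isExtendable Γ (g a) (T a) (v :: M) then v :: M else M)
    (by fun_prop) (.const []) (by fun_prop) (by fun_prop) fun a M v hv => ?_
  have := weight_lt_of_mem hv
  split_ifs
  · rw [weight_list_cons]
    omega
  · omega

theorem length_branches_le (i : Fin d) (g : FinGraph) (M : List ℕ) (r : ℕ) :
    (branches i g M r).length ≤ (d + 1) ^ r := by
  have length_expand_le (l : PartialLabelling d) : (expand i g M l).length ≤ d + 1 := by
    unfold expand
    split <;> simp [labels]
  induction r with
  | zero => simp [branches]
  | succ r ih =>
    rw [branches, List.length_flatMap, pow_succ]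
    refine (List.sum_le_card_nsmul _ (d + 1) ?_).trans ?_
    · simpa using fun l _ => length_expand_le l
    · simpa using Nat.mul_le_mul_right (d + 1) ih

theorem length_le_and_lt_order_of_mem_branches {i : Fin d} {g : FinGraph} {M : List ℕ} {r : ℕ}
    {l : PartialLabelling d} (hl : l ∈ branches i g M r) :
    l.length ≤ r ∧ ∀ e ∈ l, e.1 < g.order := by
  induction r generalizing l with
  | zero => simp_all [branches]
  | succ r ih =>
    obtain ⟨l', hl', hl⟩ := List.mem_flatMap.1 hl
    obtain ⟨length_le, lt_order⟩ := ih hl'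
    unfold expand at hl
    split at hl
    · obtain rfl := List.mem_singleton.1 hl
      exact ⟨by omega, lt_order⟩
    case _ v vs hv =>
      obtain ⟨a, -, rfl⟩ := List.mem_map.1 hl
      have v_lt : v < g.order := (FinGraph.mem_vertices.1 (hv ▸ List.mem_cons_self)).1
      exact ⟨Nat.succ_le_succ length_le, List.forall_mem_cons.2 ⟨v_lt, lt_order⟩⟩

theorem weight_branches_le (i : Fin d) (g : FinGraph) (M : List ℕ) (r : ℕ) :
    weight (branches i g M r) ≤
      (d + 1) ^ r * (r * (weight g.order + (2 * d + 1) + 2) + 2) + 1 := by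
  refine (weight_list_le (m := r * (weight g.order + (2 * d + 1) + 2) + 1) fun l hl => ?_).trans ?_
  · obtain ⟨length_le, lt_order⟩ := length_le_and_lt_order_of_mem_branches hl
    refine (weight_list_le (m := weight g.order + (2 * d + 1) + 1) fun e he => ?_).trans ?_
    · have := lt_order e he
      have := weight_label_le e.2
      change weight e.1 + weight e.2 + 1 ≤ _
      simp only [weight_nat]
      omega
    · gcongr
  · gcongr
    exact length_branches_le i g M r

theorem polyTime_branches (i : Fin d) {g : α → FinGraph} {M : α → List ℕ} {r : α → ℕ}
    (hg : PolyTime g) (hM : PolyTime M) (hr : PolyTime r)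
    (hdr : PolyBounded fun a => (d + 1) ^ r a) :
    PolyTime fun a => branches i (g a) (M a) (r a) := by
  have foldl_flatMap_expand a (n : ℕ) : (List.replicate n ()).foldl
      (fun S _ => S.flatMap (expand i (g a) (M a))) [[]] = branches i (g a) (M a) n := by
    induction n with
    | zero => rfl
    | succ n ih => rw [List.replicate_succ', List.foldl_append, ih]; rfl
  have order_bounded : PolyBounded fun a => weight (g a).order := PolyTime.polyBounded (by fun_prop)
  have hrw := hr.polyBounded
  have : PolyTime fun a => (List.replicate (r a) ()).foldl
      (fun S _ => S.flatMap (expand i (g a) (M a))) [[]] := by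
    refine PolyTime.foldl (D := fun a => (d + 1) ^ r a *
      (weight (r a) * (weight (g a).order + (2 * d + 1) + 2) + 2) + 1)
      (by fun_prop) (.const [[]]) (by fun_prop) ?_ fun a l hl => ?_
    · exact .add (.mul hdr (by fun_prop)) (.const 1)
    obtain ⟨length_le, hl⟩ := List.prefix_replicate_iff.1 hl
    rw [hl, foldl_flatMap_expand]
    refine (weight_branches_le i (g a) (M a) _).trans ?_
    gcongr
    · omega
    · rw [weight_nat]
      omega
  simpa only [foldl_flatMap_expand] using this

theorem polyTime_check {Γ : Fin d → GraphClass} {F : ℕ → ℕ} (hΓ : ∀ j, Solvable (Γ j) F)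
    (hF : Monotone F) (i : Fin d) {g : α → FinGraph} {k : α → ℕ} {l : α → PartialLabelling d}
    (hg : PolyTime g) (hk : PolyTime k) (hl : PolyTime l) (hFk : PolyBounded fun a => F (k a)) :
    PolyTime fun a => check Γ i (g a) (k a) (l a) := by
  refine .bool_and (by fun_prop) (.bool_and (by fun_prop) (.fin_all fun j => ?_))
  split_ifs with hj
  · exact hΓ j (by fun_prop) (by fun_prop) (hFk.mono fun a => hF (Nat.sub_le ..))
  · exact hΓ j (by fun_prop) (.const 0) (.const (F 0))

theorem polyTime_algorithm {Γ : Fin d → GraphClass} {F : ℕ → ℕ} (hΓ : ∀ j, Solvable (Γ j) F)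
    (hF : Monotone F) {g : α → FinGraph} {k T : α → ℕ} (hg : PolyTime g) (hk : PolyTime k)
    (hT : PolyTime T) (hFk : PolyBounded fun a => F (k a)) (hFT : PolyBounded fun a => F (T a))
    (hdT : PolyBounded fun a => (d + 1) ^ (T a + T a)) :
    PolyTime fun a => algorithm Γ (g a) (k a) (T a) := by
  refine .bool_or (by fun_prop) (.fin_any fun i => .list_any ?_ ?_)
  · exact polyTime_branches i hg (polyTime_modulator (hΓ i) hF hg hT hFT) (by fun_prop) hdT
  · exact polyTime_check hΓ hF i (by fun_prop) (by fun_prop) (by fun_prop)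
      (hFk.comp (PolyTime.fst .id).polyBounded)

end RunningTime

/-! ## Fixed-parameter tractability -/

section FixedParameter

theorem computable_add {f g : ℕ → ℕ} (hf : Computable f) (hg : Computable g) :
    Computable fun k => f k + g k :=
  Primrec.nat_add.to_comp.comp hf hg

theorem computable_mul {f g : ℕ → ℕ} (hf : Computable f) (hg : Computable g) :
    Computable fun k => f k * g k :=
  Primrec.nat_mul.to_comp.comp hf hg

theorem computable_pow {f g : ℕ → ℕ} (hf : Computable f) (hg : Computable g) :
    Computable fun k => f k ^ g k :=
  (Primrec₂.unpaired'.1 Nat.Primrec.pow).to_comp.comp hf hg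

theorem computable_sum_range {f : ℕ → ℕ} (hf : Computable f) :
    Computable fun n => ∑ k ∈ Finset.range n, f k := by
  refine (Computable.nat_rec (h := fun _ (x : ℕ × ℕ) => x.2 + f x.1) .id (.const 0) ?_).of_eq
    fun n => ?_
  · exact Primrec.nat_add.to_comp.comp (Computable.snd.comp .snd)
      (hf.comp (Computable.fst.comp .snd))
  · induction n with
    | zero => rfl
    | succ n ih => rw [Finset.sum_range_succ, ← ih]; rfl

theorem computable_sum_fin {d : ℕ} {f : Fin d → ℕ → ℕ} (hf : ∀ i, Computable (f i)) :
    Computable fun k => ∑ i, f i k := by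
  induction d with
  | zero => simpa using Computable.const 0
  | succ d ih => simpa only [Fin.sum_univ_succ] using computable_add (hf 0) (ih fun i => hf i.succ)

variable {d : ℕ} {Γ : Fin d → GraphClass}

theorem exists_monotone_solvable (tractable : ∀ i, FPT (VertexDeletion fun _ : Unit => Γ i)) :
    ∃ F : ℕ → ℕ, Computable F ∧ Monotone F ∧ ∀ i, Solvable (Γ i) F := by
  choose f hf hΓ using fun i => (tractable i).exists_solvable
  refine ⟨fun k => ∑ i, ∑ j ∈ Finset.range (k + 1), f i j,
    computable_sum_fin fun i => (computable_sum_range (hf i)).comp .succ,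
    fun k k' hk => by dsimp only; gcongr,
    fun i {_ _ _ k} hg hk hF => hΓ i hg hk (hF.mono fun a => ?_)⟩
  calc f i (k a) ≤ ∑ j ∈ Finset.range (k a + 1), f i j :=
        Finset.single_le_sum_of_canonicallyOrdered (Finset.self_mem_range_succ (k a))
    _ ≤ _ := Finset.single_le_sum_of_canonicallyOrdered
        (f := fun i => ∑ j ∈ Finset.range (k a + 1), f i j) (Finset.mem_univ i)

/-- The inputs of the algorithm. The value of `B`, which is not encoded, is part of the weight, so
that factors bounded by it are polynomial in the weight. -/
structure Input (B : ℕ → ℕ) where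
  graph : FinGraph
  k : ℕ
  T : ℕ

namespace Input

variable {B : ℕ → ℕ}

noncomputable instance : Enc (Input B) :=
  ⟨fun x => enc (x.graph, x.k, x.T), fun x => weight (x.graph, x.k, x.T) + B (x.k + x.T)⟩

theorem weight_eq (x : Input B) : weight x = weight (x.graph, x.k, x.T) + B (x.k + x.T) := rfl

theorem polyTime_toProd : PolyTime fun x : Input B => (x.graph, x.k, x.T) :=
  .of_enc_eq (fun _ => rfl) fun _ => Nat.le_add_right _ _

theorem polyBounded_of_le {f : Input B → ℕ} (hf : ∀ x, f x ≤ B (x.k + x.T)) : PolyBounded f :=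
  PolyBounded.weight.mono fun x => (hf x).trans (Nat.le_add_left _ _)

end Input

theorem exists_run_algorithm (tractable : ∀ i, FPT (VertexDeletion fun _ : Unit => Γ i)) :
    ∃ (r : Prog) (c : ℕ) (b : ℕ → ℕ), Computable b ∧ ∀ (g : FinGraph) (k T : ℕ),
      Run r (enc (g, k, T)) (enc (algorithm Γ g k T)) (b (k + T) * weight g ^ c) := by
  obtain ⟨F, computable_F, hF, hΓ⟩ := exists_monotone_solvable tractable
  let B (N : ℕ) : ℕ := F N + (d + 1) ^ (N + N)
  have computable_B : Computable B := computable_add computable_F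
    (computable_pow (.const (d + 1)) (computable_add .id .id))
  have polyTime : PolyTime fun x : Input B => algorithm Γ x.graph x.k x.T := by
    refine polyTime_algorithm hΓ hF Input.polyTime_toProd.fst Input.polyTime_toProd.snd.fst
      Input.polyTime_toProd.snd.snd ?_ ?_ ?_ <;> refine Input.polyBounded_of_le fun x => ?_
    · exact le_add_right (hF (by omega))
    · exact le_add_right (hF (by omega))
    · exact le_add_left (Nat.pow_le_pow_right (by omega) (by omega))
  obtain ⟨r, W, ⟨c, hW⟩, hr, -⟩ := polyTime
  refine ⟨r, c, fun N => (N + N + B N + 7) ^ c, computable_pow (computable_add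
    (computable_add (computable_add .id .id) computable_B) (.const 7)) (.const c),
    fun g k T => (hr ⟨g, k, T⟩).mono ?_⟩
  have weight_pos : 0 < weight g := Nat.zero_lt_of_lt (length_lt_weight g.rows)
  rw [← mul_pow]
  refine (hW _).trans (Nat.pow_le_pow_left ?_ c)
  simp only [Input.weight_eq, weight_mk, weight_nat]
  nlinarith [Nat.zero_le (k + T + B (k + T))]

theorem exists_decidesWithin (hered : ∀ i, (Γ i).IsHereditary)
    (tractable : ∀ i, FPT (VertexDeletion fun _ : Unit => Γ i)) :
    ∃ (c : ℕ) (b : ℕ → ℕ), Computable b ∧ ∀ q : Prog, ∃ p : Prog,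
      ∀ (n : ℕ) (G : SimpleGraph (Fin n)) (s k T t : ℕ), IsUnbreakable G s k → k + 3 * s ≤ T →
        Run q (enc k) (enc T) t →
        DecidesWithin p (encodeInstance G k) (VertexDeletion Γ n G k)
          ((b (k + T) + t) * (encodeGraph G).size ^ c) := by
  obtain ⟨r, c, b, hb, hr⟩ := exists_run_algorithm tractable
  refine ⟨c, fun N => b N + 100, computable_add hb (.const 100), fun q =>
    ⟨.seq (.pair (.assign 0 (.hd (.var 0))) (.pair (.assign 0 (.tl (.var 0)))
      (.seq (.assign 0 (.tl (.var 0))) q))) r, fun n G s k T t hG hT hq => ?_⟩⟩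
  have graph := Run.assign (.hd (.var 0)) (enc (FinGraph.mk n G, k))
  have parameter := Run.assign (.tl (.var 0)) (enc (FinGraph.mk n G, k))
  simp only [Expr.eval, initStore_zero, enc_mk, Data.hd, Data.tl, Expr.cost] at graph parameter
  have run := (graph.pair (parameter.pair (parameter.seq hq))).seq (hr ⟨n, G⟩ k T)
  rw [encodeInstance_eq_enc, size_encodeGraph, ← algorithm_iff hered (g := ⟨n, G⟩) hG hT]
  refine (run.mono ?_).decidesWithin
  have le_mul : 100 + t ≤ (100 + t) * weight (FinGraph.mk n G) ^ c :=
    Nat.le_mul_of_pos_right _ (Nat.pow_pos (Nat.zero_lt_of_lt (length_lt_weight _)))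
  linarith

end FixedParameter

end Scattered

theorem theorem3 {d : ℕ} (Γ : Fin d → Scattered.GraphClass)
    (hered : ∀ i, (Γ i).IsHereditary)
    (tractable : ∀ i, Scattered.FPT (Scattered.VertexDeletion (fun _ : Unit => Γ i)))
    (s : ℕ → ℕ) :
    (Computable s →
      Scattered.FPTOn (Scattered.UnbreakableInstances s) (Scattered.VertexDeletion Γ)) ∧
    Scattered.NonuniformFPTOn (Scattered.UnbreakableInstances s) (Scattered.VertexDeletion Γ) := by
  open Scattered in
  obtain ⟨c, b, hb, exists_prog⟩ := exists_decidesWithin hered tractable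
  refine ⟨fun hs => ?_, c, fun k => ?_⟩
  · have computable_T : Computable fun k => k + 3 * s k :=
      computable_add .id (computable_mul (.const 3) hs)
    obtain ⟨q, t, ht, hq⟩ := exists_run_of_computable computable_T
    obtain ⟨p, hp⟩ := exists_prog q
    exact ⟨p, fun k => b (k + (k + 3 * s k)) + t k, c,
      computable_add (hb.comp (computable_add .id computable_T)) ht,
      fun n G k hG => hp n G (s k) k _ _ hG le_rfl (hq k)⟩
  · obtain ⟨p, hp⟩ := exists_prog (.assign 0 (Enc.enc (k + 3 * s k)).toExpr)
    have hq := Run.assign (Enc.enc (k + 3 * s k)).toExpr (Enc.enc k)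
    rw [Data.eval_toExpr] at hq
    exact ⟨p, _, fun n G hG => hp n G (s k) k _ _ hG le_rfl hq⟩
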